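/- Let $\mathfrak N$ be the set of simple, locally finite configurations $\omega=\sum_{n\ge1}\epsilon_{T_n(\omega)}$, $0<T_1(\omega)<T_2(\omega)<\cdots$, $T_n(\omega)\to\infty$, let $N(\omega,t)=\omega([0,t])$ be the canonical counting process, $\mathcal N_t=\sigma\{N(s),\,s\le t\}$ and $\mathcal N_\infty=\sigma\{N(s),\,s\ge0\}$, and let $\pi$ be the probability measure on $(\mathfrak N,\mathcal N_\infty)$ under which $N$ is a Poisson process of unit rate. In the sequel, a stopping time is a $[0,\infty]$-valued map $\tau$ on $\mathfrak N$ which is a stopping time of the filtration $\mathcal N$ completed by the $\pi$-null sets, i.e. for each $s\ge 0$ the set $\{\tau\le s\}$ is $\pi$-a.s. equal to an element of $\mathcal N_s$. Let $\dot y\in\mathcal P^{++}(\mathcal N)$, that is, $\dot y$ is a (strictly) positive $\mathcal N$-predictable process such that $y(\omega,t)=\int_0^t\dot y(\omega,s)\,ds$ satisfies $\pi(y(t)<\infty)=1$ for all $t\ge0$ and $\pi(\lim_{t\to\infty}y(t)=\infty)=1$. Put $y^*(\omega,t)=\inf\{s: y(\omega,s)>t\}$ and let $\mathbf Y:\mathfrak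 N\to\mathfrak N$ be the ($\pi$-a.s. defined) map sending $N$ to the configuration with counting process $t\mapsto N(y^*(N,t))$. The following two assertions are equivalent. (1) $\mathbf Y$ has a right inverse of the form $N(z^*)$: there are a measurable $Z:\mathfrak N\to\mathfrak N$ with $Z^{\#}\pi\ll\pi$ and $\mathbf Y\circ Z=\mathrm{Id}_{\mathfrak N}$ $\pi$-a.s., and a process $z^*(N,t)$ with values in $[0,\infty]$, whose paths are $\pi$-a.s. null at $0$, non-decreasing, right-continuous, finite and tending to $\infty$, such that $z^*(N,t)$ is a stopping time for each $t>0$ and, $\pi$-a.s., $Z(t)=N(z^*(N,t))$ for all $t\ge0$. (2) There is a measurable $Z:\mathfrak N\to\mathfrak N$ whose law $Z^{\#}\pi$ is absolutely continuous with respect to $\pi$, such that, $\pi$-a.s., $Z(t)=N\bigl(y(Z,t)\bigr)$ for all $t\ge0$, and such that $y(Z,t)$ is a stopping time for each $t\ge0$. Moreover, every $Z$ as in (2) (called a generalized Hawkes process) has compensator $y(Z,\cdot)$ with respect to its own filtration. That is, under the law of $Z$, the process $y$ is $\mathcal N$-predictable and a.s. finite, null at $0$, non-decreasing and right-continuous,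 and for each $q\ge1$ the process $t\mapsto N(t\wedge T_q)-y(t\wedge T_q)$ is a uniformly integrable $\mathcal N$-martingale. -/

import Mathlib

open MeasureTheory ProbabilityTheory Filter Topology
open scoped NNReal ENNReal

noncomputable section

namespace GHawkes

/-- The space of simple, locally finite configurations `T₁ < T₂ < ⋯`, `Tₙ → ∞`, on `(0, ∞)`,
each one represented by its set of atoms. -/
@[ext]
structure Config where
  /-- the set of atoms -/
  carrier : Set ℝ≥0
  zero_notMem : (0 : ℝ≥0) ∉ carrier
  finite_Iic : ∀ t : ℝ≥0, (carrier ∩ Set.Iic t).Finite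
  infinite : carrier.Infinite

/-- The counting process `N(ω, t) = ω([0, t])`. -/
def count (ω : Config) (t : ℝ≥0) : ℕ := (ω.carrier ∩ Set.Iic t).ncard

/-- `N(ω, r) = ω([0, r])` for a possibly infinite time `r`. -/
def countE (ω : Config) (r : ℝ≥0∞) : ℕ∞ := {x ∈ ω.carrier | (x : ℝ≥0∞) ≤ r}.encard

/-- The σ-field generated by the counting process `(N(t), t ≥ 0)`, which is the Borel σ-field of
the vague topology. -/
instance : MeasurableSpace Config :=
  ⨆ t : ℝ≥0, MeasurableSpace.comap (fun ω => count ω t) ⊤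

theorem measurable_count (t : ℝ≥0) : Measurable (fun ω : Config => count ω t) :=
  Measurable.mono (comap_measurable _)
    (le_iSup (fun t : ℝ≥0 => MeasurableSpace.comap (fun ω => count ω t) ⊤) t) le_rfl

/-- The minimal filtration `𝒩ₜ = σ(N(s), s ≤ t)`. -/
def natFiltration : Filtration ℝ≥0 (inferInstance : MeasurableSpace Config) :=
  Filtration.natural (fun t ω => count ω t) (fun t => (measurable_count t).stronglyMeasurable)

/-- The `q`-th atom `T_q(ω) = inf {t | N(ω, t) = q}`. -/
def jumpTime (q : ℕ) (ω : Config) : ℝ≥0 := sInf {t | count ω t = q}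

/-- Under `π` the canonical process `N` is a Poisson process of unit rate. -/
structure IsUnitPoisson (π : Measure Config) : Prop where
  isProbabilityMeasure : IsProbabilityMeasure π
  indep_increments : ∀ s t : ℝ≥0, s ≤ t →
    Indep (MeasurableSpace.comap (fun ω => count ω t - count ω s) ⊤) (natFiltration s) π
  law_increments : ∀ s t : ℝ≥0, s ≤ t →
    π.map (fun ω => count ω t - count ω s) = poissonMeasure (t - s)

/-- The integrated process `y(ω, t) = ∫₀ᵗ ẏ(ω, s) ds` of a non-negative process `ẏ`. -/
def integrated (ydot : ℝ≥0 → Config → ℝ) (ω : Config) (t : ℝ≥0) : ℝ≥0∞ :=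
  ∫⁻ s in Set.Ioc (0 : ℝ) t, ENNReal.ofReal (ydot s.toNNReal ω)

/-- The class `𝒫⁺⁺(𝒩)`: positive predictable processes `ẏ` such that `π`-a.s. `y(t) < ∞` for every
`t`, and `y(t) → ∞` as `t → ∞`. -/
structure IsPosPredictable (π : Measure Config) (ydot : ℝ≥0 → Config → ℝ) : Prop where
  predictable : IsStronglyPredictable natFiltration ydot
  pos : ∀ t ω, 0 < ydot t ω
  finite : ∀ t, ∀ᵐ ω ∂π, integrated ydot ω t < ∞
  tendsto : ∀ᵐ ω ∂π, Tendsto (integrated ydot ω) atTop (𝓝 ∞)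

/-- The right inverse `f*(t) = inf {s | f(s) > t}`, with `inf ∅ = ∞`. -/
def rightInverse (f : ℝ≥0 → ℝ≥0∞) (t : ℝ≥0) : ℝ≥0∞ :=
  ⨅ (s : ℝ≥0) (_ : (t : ℝ≥0∞) < f s), (s : ℝ≥0∞)

/-- `ω'` is the configuration whose counting process is `t ↦ N(ω, f(t))`. -/
def IsTimeChanged (f : ℝ≥0 → ℝ≥0∞) (ω ω' : Config) : Prop :=
  ∀ t : ℝ≥0, (count ω' t : ℕ∞) = countE ω (f t)

open Classical in
/-- The map `N ↦ N ∘ η(N, ·)` from the configuration space to itself; where the path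
`t ↦ N(η(N, t))` is not the counting process of a configuration, the value is irrelevant. -/
def timeChange (η : Config → ℝ≥0 → ℝ≥0∞) (ω : Config) : Config :=
  if h : ∃ ω', IsTimeChanged (η ω) ω ω' then h.choose else ω

/-- The map `𝐘 : N ↦ N ∘ y*(N, ·)`. -/
def mapY (ydot : ℝ≥0 → Config → ℝ) : Config → Config :=
  timeChange (fun ω => rightInverse (integrated ydot ω))

/-- `𝒵` is a right inverse of `𝒴` on the probability space of configurations with law `μ`. -/
structure IsRightInverse (μ : Measure Config) (𝒴 𝒵 : Config → Config) : Prop where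
  measurable : Measurable 𝒵
  absolutelyContinuous : μ.map 𝒵 ≪ μ
  comp_eq : ∀ᵐ ω ∂μ, 𝒴 (𝒵 ω) = ω

/-- `τ` is a stopping time of the filtration obtained from `𝒩` by adding the `π`-null sets. -/
def IsStopping (π : Measure Config) (τ : Config → ℝ≥0∞) : Prop :=
  ∀ s : ℝ≥0, EventuallyMeasurableSet (natFiltration s) (ae π) {ω | τ ω ≤ s}

/-- `η` is a random change of time: `π`-a.s. its paths are null at `0`, non-decreasing,
right-continuous, finite, with limit `∞`, and `η(t)` is a stopping time for each `t > 0`. -/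
structure IsChangeOfTime (π : Measure Config) (η : Config → ℝ≥0 → ℝ≥0∞) : Prop where
  zero : ∀ᵐ ω ∂π, η ω 0 = 0
  monotone : ∀ᵐ ω ∂π, Monotone (η ω)
  rightContinuous : ∀ᵐ ω ∂π, ∀ t, ContinuousWithinAt (η ω) (Set.Ici t) t
  finite : ∀ᵐ ω ∂π, ∀ t, η ω t < ∞
  tendsto : ∀ᵐ ω ∂π, Tendsto (η ω) atTop (𝓝 ∞)
  stopping : ∀ t : ℝ≥0, 0 < t → IsStopping π (fun ω => η ω t)

/-- A generalized Hawkes process `Z` on the space of configurations under `π`: its law is absolutely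
continuous with respect to `π`, it solves `Z(t) = N(y(Z, t))`, and `y(Z, t)` is a stopping time. -/
structure IsGHawkesProcess (π : Measure Config) (ydot : ℝ≥0 → Config → ℝ)
    (Z : Config → Config) : Prop where
  measurable : Measurable Z
  absolutelyContinuous : π.map Z ≪ π
  equation : ∀ᵐ ω ∂π, IsTimeChanged (integrated ydot (Z ω)) ω (Z ω)
  stopping : ∀ t : ℝ≥0, IsStopping π (fun ω => integrated ydot (Z ω) t)

/-- Under `μ` the canonical process `N` has compensator `A` with respect to its minimal
filtration: `A` is predictable and `μ`-a.s. null at `0`, non-decreasing, finite and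
right-continuous, and for `q ≥ 1` the process `N(t ∧ T_q) - A(t ∧ T_q)` is a uniformly
integrable martingale. -/
structure HasCompensator (μ : Measure Config) (A : Config → ℝ≥0 → ℝ≥0∞) : Prop where
  predictable : IsStronglyPredictable natFiltration (fun t ω => A ω t)
  zero : ∀ᵐ ω ∂μ, A ω 0 = 0
  monotone : ∀ᵐ ω ∂μ, Monotone (A ω)
  finite : ∀ᵐ ω ∂μ, ∀ t, A ω t < ∞
  rightContinuous : ∀ᵐ ω ∂μ, ∀ t, ContinuousWithinAt (A ω) (Set.Ici t) t
  martingale : ∀ q : ℕ, 1 ≤ q → Martingale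
    (fun (t : ℝ≥0) ω => (count ω (min t (jumpTime q ω)) : ℝ) - (A ω (min t (jumpTime q ω))).toReal)
    natFiltration μ
  uniformIntegrable : ∀ q : ℕ, 1 ≤ q → UniformIntegrable
    (fun (t : ℝ≥0) ω => (count ω (min t (jumpTime q ω)) : ℝ) - (A ω (min t (jumpTime q ω))).toReal)
    1 μ

end GHawkes

end

namespace GHawkes

/-! For `π`-almost every `z` the path `y(z, ·)` is an increasing homeomorphism of `[0, ∞)`: it is a
primitive of a positive locally integrable function and it diverges. Its right inverse is then its
true inverse, and `𝐘(z) = ω` is the same as `z(t) = ω(y(z, t))` for all `t`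
(`IsRegularPath.mapY_eq_iff`). Since the law of `Z` is absolutely continuous, this applies to `z =
Z(ω)`, so the right inverses of `𝐘` are exactly the solutions of the Hawkes equation, and `z* = y(Z,
·)` is a suitable change of time.

The stopping property comes for free. By predictability `y(z, t)` reads `z` only on `[0, t)`, so if
two driving configurations agree up to `r`, their solutions agree as long as the clock has not
passed `r` (`Solves.agreeUpTo`, by a first-difference argument). Hence `{y(Z, t) ≤ s}` is almost
surely decided by the atoms on `[0, s]`. To place such an event in the completed `𝒩ₛ`, the driving
configuration is given an independent tail after `s`; independent increments leave the Poisson law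
unchanged (`IsUnitPoisson.map_glue`), and Fubini selects one fixed tail that works almost surely
(`IsUnitPoisson.eventuallyMeasurableSet`).

For the compensator, put `M(t) = N(t) - t`. The homeomorphism `y(Z, ·)` carries the `q`-th atom of
`Z` to that of `N`, so the stopped compensated process at `Z` equals `M(y(Z, t) ∧ T_q)`. Optional
stopping under `π` (`IsUnitPoisson.optional_stopping`) gives the martingale property, and the bound
`q + T_q`, integrable under `π`, gives uniform integrability. -/

/-! ### Counting functions, atoms and jump times -/

theorem count_mono (ω : Config) : Monotone (count ω) := fun _ t h =>
  Set.ncard_le_ncard (Set.inter_subset_inter_right _ (Set.Iic_subset_Iic.2 h)) (ω.finite_Iic t)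

theorem count_zero (ω : Config) : count ω 0 = 0 := by
  rw [count, Set.ncard_eq_zero (ω.finite_Iic 0)]
  ext x
  simp only [Set.mem_inter_iff, Set.mem_Iic, nonpos_iff_eq_zero, Set.mem_empty_iff_false,
    iff_false, not_and]
  rintro hx rfl
  exact ω.zero_notMem hx

theorem countE_coe (ω : Config) (t : ℝ≥0) : countE ω t = count ω t := by
  rw [countE, count, (ω.finite_Iic t).cast_ncard_eq]
  congr 1
  ext x
  simp

theorem exists_right_gap (ω : Config) (x : ℝ≥0) : ∃ v > x, ∀ y ∈ ω.carrier, x < y → v ≤ y := by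
  have hF : (ω.carrier ∩ Set.Iic (x + 1) ∩ Set.Ioi x).Finite :=
    (ω.finite_Iic _).subset Set.inter_subset_left
  have hx : (ω.carrier ∩ Set.Iic (x + 1) ∩ Set.Ioi x)ᶜ ∈ 𝓝 x :=
    hF.isClosed.isOpen_compl.mem_nhds (by simp)
  obtain ⟨u, hu, hsub⟩ := exists_Ico_subset_of_mem_nhds hx ⟨x + 1, by simp⟩
  refine ⟨min u (x + 1), lt_min hu (by simp), fun y hy hxy => ?_⟩
  by_contra! h
  rw [lt_min_iff] at h
  exact hsub ⟨hxy.le, h.1⟩ ⟨⟨hy, h.2.le⟩, hxy⟩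

theorem exists_left_gap (ω : Config) {x : ℝ≥0} (hx0 : 0 < x) :
    ∃ v < x, ∀ y ∈ ω.carrier, y < x → y ≤ v := by
  have hF : (ω.carrier ∩ Set.Iic x ∩ Set.Iio x).Finite :=
    (ω.finite_Iic _).subset Set.inter_subset_left
  have hx : (ω.carrier ∩ Set.Iic x ∩ Set.Iio x)ᶜ ∈ 𝓝 x :=
    hF.isClosed.isOpen_compl.mem_nhds (by simp)
  obtain ⟨u, hu, hsub⟩ := exists_Ioc_subset_of_mem_nhds hx ⟨0, hx0⟩
  refine ⟨u, hu, fun y hy hxy => ?_⟩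
  by_contra! h
  exact hsub ⟨h, hxy.le⟩ ⟨⟨hy, hxy.le⟩, hxy⟩

theorem exists_count_eq_right (ω : Config) (t : ℝ≥0) :
    ∃ v > t, ∀ u, t ≤ u → u < v → count ω u = count ω t := by
  obtain ⟨v, hv, h⟩ := exists_right_gap ω t
  refine ⟨v, hv, fun u htu huv => ?_⟩
  rw [count, count]
  congr 1
  ext y
  simp only [Set.mem_inter_iff, Set.mem_Iic, and_congr_right_iff]
  exact fun hy => ⟨fun hyu => not_lt.1 fun hty => absurd (h y hy hty) (not_le.2 (hyu.trans_lt huv)),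
    fun hyt => hyt.trans htu⟩

/-- Local finiteness leaves a gap to the left of any `x > 0`, so a non-atom `x` has an earlier time
with the same count. Consequently the counting function determines the configuration. -/
theorem mem_carrier_iff (ω : Config) {x : ℝ≥0} :
    x ∈ ω.carrier ↔ 0 < x ∧ ∀ s < x, count ω s < count ω x := by
  constructor
  · intro hx
    refine ⟨pos_iff_ne_zero.2 fun h => ω.zero_notMem (h ▸ hx), fun s hs => ?_⟩
    refine Set.ncard_lt_ncard ⟨Set.inter_subset_inter_right _ (Set.Iic_subset_Iic.2 hs.le), ?_⟩
      (ω.finite_Iic x)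
    intro h
    exact absurd (h ⟨hx, Set.self_mem_Iic⟩).2 (not_le.2 hs)
  · rintro ⟨hx0, h⟩
    by_contra hx
    obtain ⟨v, hv, hg⟩ := exists_left_gap ω hx0
    refine (h v hv).not_ge (Set.ncard_le_ncard (fun y hy => ⟨hy.1, hg y hy.1 ?_⟩) (ω.finite_Iic v))
    exact lt_of_le_of_ne hy.2 fun e => hx (e ▸ hy.1)

theorem Config.ext_count {ω ω' : Config} (h : ∀ t, count ω t = count ω' t) : ω = ω' := by
  ext x
  simp only [mem_carrier_iff, h]

/-- A configuration is infinite and locally finite, so there is always a next atom. This makes the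
infimum in `jumpTime` an attained minimum rather than the default value of `sInf ∅`. -/
theorem exists_first_count (ω : Config) (q : ℕ) :
    ∃ t, count ω t = q ∧ ∀ s < t, count ω s < q := by
  induction q with
  | zero => exact ⟨0, count_zero ω, fun s hs => absurd hs (not_lt_zero)⟩
  | succ q ih =>
    obtain ⟨t, ht, -⟩ := ih
    have hinf : (ω.carrier \ (ω.carrier ∩ Set.Iic t)).Infinite := ω.infinite.sdiff (ω.finite_Iic t)
    obtain ⟨y, hy, hyt⟩ := hinf.nonempty
    have hty : t < y := not_le.1 fun h => hyt ⟨hy, h⟩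
    obtain ⟨x, ⟨⟨hx, hxy⟩, htx⟩, hmin⟩ := Set.exists_min_image
      (ω.carrier ∩ Set.Iic y ∩ Set.Ioi t) id ((ω.finite_Iic y).subset Set.inter_subset_left)
      ⟨y, ⟨hy, Set.self_mem_Iic⟩, hty⟩
    have htx : t < x := htx
    have hgap : ∀ z ∈ ω.carrier, z < x → z ≤ t := fun z hz hzx => not_lt.1 fun htz =>
      absurd (hmin z ⟨⟨hz, hzx.le.trans hxy⟩, htz⟩) (not_le.2 hzx)
    refine ⟨x, ?_, fun s hs => Nat.lt_succ_of_le ?_⟩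
    · have : ω.carrier ∩ Set.Iic x = insert x (ω.carrier ∩ Set.Iic t) := by
        ext z
        simp only [Set.mem_inter_iff, Set.mem_Iic, Set.mem_insert_iff]
        constructor
        · rintro ⟨hz, hzx⟩
          rcases eq_or_lt_of_le hzx with e | h
          · exact Or.inl e
          · exact Or.inr ⟨hz, hgap z hz h⟩
        · rintro (rfl | ⟨hz, hzt⟩)
          · exact ⟨hx, le_rfl⟩
          · exact ⟨hz, hzt.trans htx.le⟩
      rw [count, this, Set.ncard_insert_of_notMem (fun h => absurd h.2 (not_le.2 htx))
        (ω.finite_Iic t)]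
      exact congrArg (· + 1) ht
    · rw [← ht]
      exact Set.ncard_le_ncard (fun z hz => ⟨hz.1, hgap z hz.1 (lt_of_le_of_lt hz.2 hs)⟩)
        (ω.finite_Iic t)

theorem jumpTime_spec (ω : Config) (q : ℕ) :
    count ω (jumpTime q ω) = q ∧ ∀ s < jumpTime q ω, count ω s < q := by
  obtain ⟨t, ht, h⟩ := exists_first_count ω q
  have : jumpTime q ω = t :=
    IsLeast.csInf_eq ⟨ht, fun s hs => not_lt.1 fun hst => (h s hst).ne hs⟩
  rw [this]
  exact ⟨ht, h⟩

theorem jumpTime_le_iff (ω : Config) (q : ℕ) (t : ℝ≥0) : jumpTime q ω ≤ t ↔ q ≤ count ω t := by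
  constructor
  · intro h
    exact (jumpTime_spec ω q).1.symm.le.trans (count_mono ω h)
  · intro h
    by_contra! h'
    exact ((jumpTime_spec ω q).2 t h').not_ge h

theorem count_min_jumpTime (ω : Config) (q : ℕ) (t : ℝ≥0) :
    count ω (min t (jumpTime q ω)) = min (count ω t) q := by
  rw [(count_mono ω).map_min, (jumpTime_spec ω q).1]

/-! ### Gluing configurations, and dependence on the past -/

/-- The configuration with the atoms of `ω` on `[0, r]` and those of `ω'` on `(r, ∞)`. -/
def glue (r : ℝ≥0) (ω ω' : Config) : Config where
  carrier := ω.carrier ∩ Set.Iic r ∪ ω'.carrier ∩ Set.Ioi r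
  zero_notMem := by
    rintro (h | h)
    · exact ω.zero_notMem h.1
    · exact ω'.zero_notMem h.1
  finite_Iic t := ((ω.finite_Iic r).union (ω'.finite_Iic t)).subset (by
    rintro x ⟨h | h, ht⟩
    · exact Or.inl h
    · exact Or.inr ⟨h.1, ht⟩)
  infinite := (ω'.infinite.sdiff (ω'.finite_Iic r)).mono (by
    rintro x ⟨hx, h⟩
    exact Or.inr ⟨hx, Set.mem_Ioi.2 (not_le.1 fun hxr => h ⟨hx, hxr⟩)⟩)

theorem count_glue_of_le {r u : ℝ≥0} (h : u ≤ r) (ω ω' : Config) :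
    count (glue r ω ω') u = count ω u := by
  rw [count, count]
  congr 1
  ext x
  simp only [glue, Set.mem_inter_iff, Set.mem_union, Set.mem_Iic, Set.mem_Ioi]
  constructor
  · rintro ⟨h1 | h1, h2⟩
    · exact ⟨h1.1, h2⟩
    · exact absurd (h2.trans h) (not_le.2 h1.2)
  · rintro ⟨h1, h2⟩
    exact ⟨Or.inl ⟨h1, h2.trans h⟩, h2⟩

theorem count_glue_of_ge {r u : ℝ≥0} (h : r ≤ u) (ω ω' : Config) :
    count (glue r ω ω') u = count ω r + (count ω' u - count ω' r) := by
  have h1 : (glue r ω ω').carrier ∩ Set.Iic u =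
      (ω.carrier ∩ Set.Iic r) ∪ ((ω'.carrier ∩ Set.Iic u) \ (ω'.carrier ∩ Set.Iic r)) := by
    ext x
    simp only [glue, Set.mem_inter_iff, Set.mem_union, Set.mem_Iic, Set.mem_Ioi, Set.mem_sdiff]
    constructor
    · rintro ⟨h1 | h1, h2⟩
      · exact Or.inl h1
      · exact Or.inr ⟨⟨h1.1, h2⟩, fun h3 => absurd h3.2 (not_le.2 h1.2)⟩
    · rintro (h1 | ⟨h1, h2⟩)
      · exact ⟨Or.inl h1, h1.2.trans h⟩
      · exact ⟨Or.inr ⟨h1.1, not_le.1 fun h3 => h2 ⟨h1.1, h3⟩⟩, h1.2⟩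
  rw [count, h1, Set.ncard_union_eq ?_ (ω.finite_Iic r) ((ω'.finite_Iic u).subset Set.sdiff_subset),
    Set.ncard_sdiff (Set.inter_subset_inter_right _ (Set.Iic_subset_Iic.2 h)) (ω'.finite_Iic r)]
  · rfl
  · rw [Set.disjoint_left]
    rintro x hx ⟨hx', h'⟩
    exact h' ⟨hx'.1, hx.2⟩

/-- `ω` and `ω'` have the same atoms on `[0, r]`. -/
def AgreeUpTo (r : ℝ≥0) (ω ω' : Config) : Prop := ∀ u ≤ r, count ω u = count ω' u

theorem AgreeUpTo.symm {r : ℝ≥0} {ω ω' : Config} (h : AgreeUpTo r ω ω') : AgreeUpTo r ω' ω :=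
  fun u hu => (h u hu).symm

theorem agreeUpTo_glue (r : ℝ≥0) (ω ω' : Config) : AgreeUpTo r (glue r ω ω') ω :=
  fun _ hu => count_glue_of_le hu ω ω'

theorem AgreeUpTo.jumpTime_eq {r : ℝ≥0} {ω ω' : Config} (h : AgreeUpTo r ω ω') {q : ℕ}
    (hq : jumpTime q ω ≤ r) : jumpTime q ω' = jumpTime q ω := by
  refine le_antisymm ?_ ?_
  · rw [jumpTime_le_iff, ← h _ hq, ← jumpTime_le_iff]
  · by_contra! h1
    have h2 := (jumpTime_spec ω' q).1
    rw [← h _ (h1.le.trans hq)] at h2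
    exact ((jumpTime_spec ω q).2 _ h1).ne h2

theorem AgreeUpTo.le_jumpTime_iff {r t : ℝ≥0} {ω ω' : Config} (h : AgreeUpTo r ω ω') {q : ℕ}
    (ht : t ≤ r) : t ≤ jumpTime q ω ↔ t ≤ jumpTime q ω' := by
  have aux : ∀ {ω ω' : Config}, AgreeUpTo r ω ω' → t ≤ jumpTime q ω → t ≤ jumpTime q ω' := by
    intro ω ω' h h1
    by_contra! h2
    rw [h.symm.jumpTime_eq (h2.le.trans ht)] at h1
    exact h2.not_ge h1
  exact ⟨aux h, aux h.symm⟩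

theorem natFiltration_apply (r : ℝ≥0) : (natFiltration r : MeasurableSpace Config) =
    ⨆ u ≤ r, MeasurableSpace.comap (fun ω => count ω u) ⊤ := rfl

theorem measurable_natFiltration_count {u r : ℝ≥0} (h : u ≤ r) :
    Measurable[natFiltration r] (fun ω : Config => count ω u) := by
  rw [measurable_iff_comap_le, natFiltration_apply]
  exact le_iSup₂_of_le u h le_rfl

theorem measurable_config_iff {α : Type*} [MeasurableSpace α] {f : α → Config} :
    Measurable f ↔ ∀ t, Measurable fun a => count (f a) t := by
  refine ⟨fun h t => (measurable_count t).comp h, fun h => ?_⟩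
  refine Measurable.of_comap_le ?_
  rw [instMeasurableSpaceConfig, MeasurableSpace.comap_iSup]
  refine iSup_le fun t => ?_
  rw [MeasurableSpace.comap_comp]
  exact (h t).comap_le

/-- The sets that do not separate `ω` from `ω'` form a σ-field, and it contains the generators of
`𝒩ᵣ`. -/
theorem AgreeUpTo.mem_iff {r : ℝ≥0} {ω ω' : Config} (h : AgreeUpTo r ω ω') {A : Set Config}
    (hA : MeasurableSet[natFiltration r] A) : ω ∈ A ↔ ω' ∈ A := by
  have hle : (natFiltration r : MeasurableSpace Config) ≤
      { MeasurableSet' := fun B => ω ∈ B ↔ ω' ∈ B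
        measurableSet_empty := by simp
        measurableSet_compl := fun B hB => by simp [hB]
        measurableSet_iUnion := fun f hf => by simp [hf] } := by
    rw [natFiltration_apply]
    refine iSup₂_le fun u hu => ?_
    rintro B ⟨S, -, rfl⟩
    change count ω u ∈ S ↔ count ω' u ∈ S
    rw [h u hu]
  exact hle A hA

theorem AgreeUpTo.eq_of_measurable {β : Type*} [MeasurableSpace β] [MeasurableSingletonClass β]
    {r : ℝ≥0} {ω ω' : Config} (h : AgreeUpTo r ω ω') {f : Config → β}
    (hf : Measurable[natFiltration r] f) : f ω = f ω' := by
  have := h.mem_iff (hf (measurableSet_singleton (f ω)))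
  exact (this.1 rfl).symm

theorem measurable_natFiltration_glue (r : ℝ≥0) (ω' : Config) :
    Measurable[natFiltration r] (fun ω => glue r ω ω') := by
  refine (@measurable_config_iff _ (natFiltration r) _).2 fun t => ?_
  rcases le_total t r with h | h
  · simp only [count_glue_of_le h]
    exact measurable_natFiltration_count h
  · simp only [count_glue_of_ge h]
    exact (measurable_natFiltration_count le_rfl).add_const _

/-- Galmarino's test: replacing everything after `r` by a fixed tail does not change `f`, and the
replacement is an `𝒩ᵣ`-measurable map. -/
theorem measurable_natFiltration_of_agreeUpTo {β : Type*} [MeasurableSpace β] {r : ℝ≥0}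
    {f : Config → β} (hf : Measurable f) (h : ∀ ω ω', AgreeUpTo r ω ω' → f ω = f ω') :
    Measurable[natFiltration r] f := by
  rcases isEmpty_or_nonempty Config with hE | ⟨⟨ω'⟩⟩
  · intro s _
    rw [Set.eq_empty_of_isEmpty (f ⁻¹' s)]
    exact @MeasurableSet.empty _ (natFiltration r)
  · have : f = f ∘ fun ω => glue r ω ω' := funext fun ω => (h _ _ (agreeUpTo_glue r ω ω')).symm
    rw [this]
    exact hf.comp (measurable_natFiltration_glue r ω')

theorem measurable_glue (r : ℝ≥0) : Measurable fun p : Config × Config => glue r p.1 p.2 := by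
  refine measurable_config_iff.2 fun t => ?_
  rcases le_total t r with h | h
  · simp only [count_glue_of_le h]
    exact (measurable_count t).comp measurable_fst
  · simp only [count_glue_of_ge h]
    exact ((measurable_count r).comp measurable_fst).add
      (((measurable_count t).comp measurable_snd).sub ((measurable_count r).comp measurable_snd))

theorem measurable_jumpTime (q : ℕ) : Measurable (jumpTime q) := by
  refine measurable_of_Iic fun t => ?_
  have : jumpTime q ⁻¹' Set.Iic t = (fun ω => count ω t) ⁻¹' Set.Ici q := by
    ext ω
    exact jumpTime_le_iff ω q t
  rw [this]
  exact measurable_count t measurableSet_Ici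

theorem measurable_uncurry_count : Measurable fun p : ℝ≥0 × Config => count p.2 p.1 := by
  refine measurable_of_Ici fun q => ?_
  have : (fun p : ℝ≥0 × Config => count p.2 p.1) ⁻¹' Set.Ici q =
      {p : ℝ≥0 × Config | jumpTime q p.2 ≤ p.1} := by
    ext p
    exact (jumpTime_le_iff _ _ _).symm
  rw [this]
  exact measurableSet_le ((measurable_jumpTime q).comp measurable_snd) measurable_fst

/-! ### Invariance of the Poisson law under gluing -/

/-- The configurations with the same increments as `ω` between `r` and each time in `F`. -/
def sameIncrements (r : ℝ≥0) (F : Finset ℝ≥0) (ω : Config) : Set Config :=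
  {ω' | ∀ u ∈ F, count ω' u - count ω' r = count ω u - count ω r}

theorem measurableSet_sameIncrements {r s : ℝ≥0} {F : Finset ℝ≥0} (ω : Config)
    (hr : r ≤ s) (hF : ∀ u ∈ F, u ≤ s) :
    MeasurableSet[natFiltration s] (sameIncrements r F ω) := by
  have : sameIncrements r F ω =
      ⋂ u ∈ F, (fun ω' => count ω' u - count ω' r) ⁻¹' {count ω u - count ω r} := by
    ext ω'
    simp [sameIncrements]
  rw [this]
  refine Finset.measurableSet_biInter F fun u hu => ?_
  exact (measurable_natFiltration_count (hF u hu)).sub (measurable_natFiltration_count hr)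
    (measurableSet_singleton _)

/-- Independence of one increment from the past is upgraded to independence of `𝒩ᵣ` from all later
increments jointly, by peeling off the latest time of `F`. -/
theorem IsUnitPoisson.measure_inter_sameIncrements {π : Measure Config} (hπ : IsUnitPoisson π)
    (r : ℝ≥0) (ω : Config) (F : Finset ℝ≥0) (hF : ∀ u ∈ F, r ≤ u) (A : Set Config)
    (hA : MeasurableSet[natFiltration r] A) :
    π (A ∩ sameIncrements r F ω) = π A * π (sameIncrements r F ω) := by
  have := hπ.isProbabilityMeasure
  induction F using Finset.induction_on_max generalizing A with
  | empty => simp [sameIncrements]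
  | insert u F hu ih =>
    have hFr : ∀ v ∈ F, r ≤ v := fun v hv => hF v (Finset.mem_insert_of_mem hv)
    have hru : r ≤ u := hF u (Finset.mem_insert_self _ _)
    -- `v` is the last time before `u`; inserting `r` covers the case of empty `F`.
    obtain ⟨v, hv, hmax⟩ := (insert r F).exists_max_image id ⟨r, Finset.mem_insert_self _ _⟩
    have hrv : r ≤ v := hmax r (Finset.mem_insert_self _ _)
    have hFv : ∀ w ∈ F, w ≤ v := fun w hw => hmax w (Finset.mem_insert_of_mem hw)
    have hvu : v ≤ u := by
      rcases Finset.mem_insert.1 hv with rfl | hv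
      · exact hru
      · exact (hu v hv).le
    set D : Set Config := (fun ω' => count ω' u - count ω' v) ⁻¹' {count ω u - count ω v} with hD
    have hsplit : sameIncrements r (insert u F) ω = sameIncrements r F ω ∩ D := by
      ext ω'
      simp only [sameIncrements, Set.mem_ofPred_eq, Set.mem_inter_iff, Finset.forall_mem_insert,
        and_comm (a := count ω' u - count ω' r = _), hD, Set.mem_preimage, Set.mem_singleton_iff,
        and_congr_right_iff]
      intro h
      have h1 : count ω' v - count ω' r = count ω v - count ω r := by
        rcases Finset.mem_insert.1 hv with rfl | hv
        · simp
        · exact h v hv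
      have := count_mono ω hrv
      have := count_mono ω hvu
      have := count_mono ω' hrv
      have := count_mono ω' hvu
      omega
    have hind : ∀ B, MeasurableSet[natFiltration v] B → π (B ∩ D) = π D * π B := by
      intro B hB
      rw [Set.inter_comm]
      exact (Indep_iff _ _ _).1 (hπ.indep_increments v u hvu) D B
        ⟨{count ω u - count ω v}, trivial, rfl⟩ hB
    have hS := measurableSet_sameIncrements ω hrv hFv
    -- The increment over `(v, u]` is split off twice, once with `A` and once without it.
    rw [hsplit, ← Set.inter_assoc, hind _ ((natFiltration.mono hrv _ hA).inter hS), hind _ hS,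
      ih hFr A hA]
    ring

/-- Both laws are compared on the π-system of events "past in `A`, prescribed increments after `r`".
The glued configuration takes the past from one factor and the increments from the other, so its law
gives a product, as independence does for `π`. -/
theorem IsUnitPoisson.map_glue {π : Measure Config} (hπ : IsUnitPoisson π) (r : ℝ≥0) :
    (π.prod π).map (fun p => glue r p.1 p.2) = π := by
  have := hπ.isProbabilityMeasure
  have hprob : IsProbabilityMeasure ((π.prod π).map (fun p => glue r p.1 p.2)) :=
    Measure.isProbabilityMeasure_map (measurable_glue r).aemeasurable
  let C : Set (Set Config) := {B | ∃ A F ω, MeasurableSet[natFiltration r] A ∧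
    (∀ u ∈ F, r ≤ u) ∧ B = A ∩ sameIncrements r F ω}
  have hsame : ∀ F ω, (∀ u ∈ F, r ≤ u) → MeasurableSet (sameIncrements r F ω) := by
    intro F ω hF
    have : ∀ u ∈ F, u ≤ max r (F.sup id) := fun u hu =>
      le_max_of_le_right (Finset.le_sup (f := id) hu)
    exact natFiltration.le _ _ (measurableSet_sameIncrements ω (le_max_left _ _) this)
  refine ext_of_generate_finite C ?_ ?_ ?_ (by simp)
  · refine le_antisymm ?_ ?_
    · refine iSup_le fun t => ?_
      rw [← measurable_iff_comap_le]
      have hle : ∀ t ≤ r, Measurable[MeasurableSpace.generateFrom C] fun ω => count ω t := by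
        intro t ht
        refine @measurable_to_countable' _ _ _ _ (MeasurableSpace.generateFrom C) _ fun k => ?_
        rcases Set.eq_empty_or_nonempty ((fun ω => count ω t) ⁻¹' {k}) with he | ⟨ω, -⟩
        · rw [he]
          exact @MeasurableSet.empty _ (MeasurableSpace.generateFrom C)
        · refine MeasurableSpace.measurableSet_generateFrom
            ⟨_, ∅, ω, measurable_natFiltration_count ht (measurableSet_singleton k), by simp, ?_⟩
          simp [sameIncrements]
      rcases le_total t r with h | h
      · exact hle t h
      · have : (fun ω => count ω t) = fun ω => count ω r + (count ω t - count ω r) :=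
          funext fun ω => (Nat.add_sub_cancel' (count_mono ω h)).symm
        rw [this]
        refine Measurable.add (hle r le_rfl) ?_
        refine @measurable_to_countable' _ _ _ _ (MeasurableSpace.generateFrom C) _ fun k => ?_
        rcases Set.eq_empty_or_nonempty ((fun ω => count ω t - count ω r) ⁻¹' {k}) with he | ⟨ω, hω⟩
        · rw [he]
          exact @MeasurableSet.empty _ (MeasurableSpace.generateFrom C)
        · refine MeasurableSpace.measurableSet_generateFrom
            ⟨Set.univ, {t}, ω, @MeasurableSet.univ _ (natFiltration r), by simpa using h, ?_⟩
          have hω : count ω t - count ω r = k := hω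
          ext ω'
          simp [sameIncrements, hω]
    · refine MeasurableSpace.generateFrom_le ?_
      rintro _ ⟨A, F, ω, hA, hF, rfl⟩
      exact (natFiltration.le r _ hA).inter (hsame F ω hF)
  -- A point `ω''` of the nonempty intersection serves as common reference configuration for both
  -- increment conditions.
  · rintro _ ⟨A, F, ω, hA, hF, rfl⟩ _ ⟨B, G, ω', hB, hG, rfl⟩ ⟨ω'', h1, h2⟩
    refine ⟨A ∩ B, F ∪ G, ω'', hA.inter hB, ?_, ?_⟩
    · intro u hu
      rcases Finset.mem_union.1 hu with h | h
      exacts [hF u h, hG u h]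
    · have e1 : sameIncrements r F ω = sameIncrements r F ω'' := by
        ext η
        exact forall₂_congr fun u hu => by rw [h1.2 u hu]
      have e2 : sameIncrements r G ω' = sameIncrements r G ω'' := by
        ext η
        exact forall₂_congr fun u hu => by rw [h2.2 u hu]
      have e3 : sameIncrements r (F ∪ G) ω'' =
          sameIncrements r F ω'' ∩ sameIncrements r G ω'' := by
        ext η
        simp only [sameIncrements, Finset.mem_union, Set.mem_ofPred_eq, Set.mem_inter_iff,
          or_imp, forall_and]
      rw [e1, e2, e3, Set.inter_inter_inter_comm]
  · rintro _ ⟨A, F, ω, hA, hF, rfl⟩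
    rw [Measure.map_apply (measurable_glue r) ((natFiltration.le r _ hA).inter (hsame F ω hF)),
      hπ.measure_inter_sameIncrements r ω F hF A hA, ← Measure.prod_prod]
    congr 1
    ext p
    refine and_congr ((agreeUpTo_glue r p.1 p.2).mem_iff hA) (forall₂_congr fun u hu => ?_)
    rw [count_glue_of_ge (hF u hu), count_glue_of_le le_rfl, Nat.add_sub_cancel_left]

/-- An event that is almost surely a function of the atoms on `[0, r]` belongs to the completion
of `𝒩ᵣ`. -/
theorem IsUnitPoisson.eventuallyMeasurableSet {π : Measure Config} (hπ : IsUnitPoisson π)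
    {r : ℝ≥0} {B : Set Config} (hB : MeasurableSet B) {P : Config → Prop} (hP : ∀ᵐ ω ∂π, P ω)
    (h : ∀ ω ω', P ω → P ω' → AgreeUpTo r ω ω' → ω ∈ B → ω' ∈ B) :
    EventuallyMeasurableSet (natFiltration r) (ae π) B := by
  have := hπ.isProbabilityMeasure
  have h1 : ∀ᵐ p ∂(π.prod π), P (glue r p.1 p.2) := by
    refine ae_of_ae_map (measurable_glue r).aemeasurable ?_
    rwa [hπ.map_glue r]
  rw [← Measure.prod_swap] at h1
  have h2 : ∀ᵐ p ∂(π.prod π), P (glue r p.2 p.1) :=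
    ae_of_ae_map measurable_swap.aemeasurable h1
  -- By Fubini, one tail `ω'` is good for almost every past. With it fixed, the glued configuration
  -- depends on `ω` in an `𝒩ᵣ`-measurable way.
  obtain ⟨ω', hω'⟩ := (Measure.ae_ae_of_ae_prod h2).exists
  refine ⟨(fun ω => glue r ω ω') ⁻¹' B, measurable_natFiltration_glue r ω' hB, ?_⟩
  filter_upwards [hP, hω'] with ω hω hω2
  have hag := agreeUpTo_glue r ω ω'
  exact propext ⟨h _ _ hω hω2 hag.symm, h _ _ hω2 hω hag⟩

/-! ### Predictability of the integrated process -/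

theorem predictable_le_prod :
    natFiltration.predictable ≤ (inferInstance : MeasurableSpace (ℝ≥0 × Config)) :=
  measurableSpace_le_predictable_of_measurableSet
    (fun _ hA => (measurableSet_singleton _).prod (natFiltration.le _ _ hA))
    (fun _ _ hA => measurableSet_Ioi.prod (natFiltration.le _ _ hA))

theorem measurable_predictable_fst :
    Measurable[natFiltration.predictable] (Prod.fst : ℝ≥0 × Config → ℝ≥0) := by
  let : MeasurableSpace (ℝ≥0 × Config) := natFiltration.predictable
  refine measurable_of_Ioi fun i => ?_
  have : (Prod.fst : ℝ≥0 × Config → ℝ≥0) ⁻¹' Set.Ioi i = Set.Ioi i ×ˢ Set.univ := by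
    ext p
    simp
  rw [this]
  exact measurableSet_predictable_Ioi_prod (@MeasurableSet.univ _ (natFiltration i))

/-- Evaluation of a predictable process at a deterministic time before the current one. -/
noncomputable def evalBefore (p : ℝ × (ℝ≥0 × Config)) : ℝ≥0 × Config :=
  if p.1.toNNReal < p.2.1 then (p.1.toNNReal, p.2.2) else (0, p.2.2)

/-- This makes `ẏ(s, ω) 1{0 < s < t}` jointly measurable in `s` and, predictably, in `(t, ω)`;
integrating out `s` then gives a predictable `y`. When `s ≥ t` the fallback time `0` uses only
information from `𝒩₀`. -/
theorem measurable_evalBefore : Measurable[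
    (inferInstance : MeasurableSpace ℝ).prod natFiltration.predictable, natFiltration.predictable]
    evalBefore := by
  let : MeasurableSpace (ℝ≥0 × Config) := natFiltration.predictable
  have hfst : Measurable fun p : ℝ × (ℝ≥0 × Config) => p.2.1 :=
    measurable_predictable_fst.comp measurable_snd
  have htime : Measurable fun p : ℝ × (ℝ≥0 × Config) => p.1.toNNReal :=
    measurable_real_toNNReal.comp measurable_fst
  refine measurable_generateFrom ?_
  rintro _ (⟨A, hA, rfl⟩ | ⟨i, A, hA, rfl⟩)
  · have hA' : MeasurableSet ({0} ×ˢ A ∪ Set.Ioi 0 ×ˢ A : Set (ℝ≥0 × Config)) :=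
      (measurableSet_predictable_singleton_bot_prod hA).union
        (measurableSet_predictable_Ioi_prod hA)
    have : evalBefore ⁻¹' ({⊥} ×ˢ A) =
        ({p | p.1.toNNReal = 0} ∪ {p | p.2.1 ≤ p.1.toNNReal}) ∩
          Prod.snd ⁻¹' ({0} ×ˢ A ∪ Set.Ioi 0 ×ˢ A) := by
      ext ⟨s, t, ω⟩
      rcases lt_or_ge s.toNNReal t with h | h
      · have := (zero_le (a := s.toNNReal)).trans_lt h
        simp [evalBefore, h, this, this.ne', h.not_ge, -Real.toNNReal_eq_zero]
      · have h0 : t = 0 ∨ 0 < t := (zero_le (a := t)).eq_or_lt.imp_left Eq.symm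
        simp only [evalBefore, Set.mem_preimage, not_lt.2 h, if_false]
        simp [h, ← or_and_right, h0, -Real.toNNReal_eq_zero]
    rw [this]
    exact ((htime (measurableSet_singleton 0)).union (measurableSet_le hfst htime)).inter
      (measurable_snd hA')
  · have : evalBefore ⁻¹' (Set.Ioi i ×ˢ A) =
        ({p | i < p.1.toNNReal} ∩ {p | p.1.toNNReal < p.2.1}) ∩ Prod.snd ⁻¹' (Set.Ioi i ×ˢ A) := by
      ext ⟨s, t, ω⟩
      rcases lt_or_ge s.toNNReal t with h | h
      · simp only [evalBefore, Set.mem_preimage, h, if_true, Set.mem_prod, Set.mem_Ioi,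
          Set.mem_inter_iff, Set.mem_ofPred_eq]
        exact ⟨fun h' => ⟨⟨h'.1, trivial⟩, h'.1.trans h, h'.2⟩, fun h' => ⟨h'.1.1, h'.2.2⟩⟩
      · simp [evalBefore, not_lt.2 h]
    rw [this]
    exact ((measurableSet_lt measurable_const htime).inter (measurableSet_lt htime hfst)).inter
      (measurable_snd (measurableSet_predictable_Ioi_prod hA))

variable {ydot : ℝ≥0 → Config → ℝ}

theorem integrated_eq_lintegral_evalBefore (ydot : ℝ≥0 → Config → ℝ) (p : ℝ≥0 × Config) :
    integrated ydot p.2 p.1 = ∫⁻ s : ℝ, {q : ℝ × (ℝ≥0 × Config) | 0 < q.1 ∧ q.1 < q.2.1}.indicator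
      (fun q => ENNReal.ofReal (Function.uncurry ydot (evalBefore q))) (s, p) := by
  obtain ⟨t, ω⟩ := p
  rw [integrated, ← restrict_Ioo_eq_restrict_Ioc, ← lintegral_indicator measurableSet_Ioo]
  refine lintegral_congr fun s => ?_
  by_cases h : 0 < s ∧ s < t
  · have h' : s.toNNReal < t := (Real.toNNReal_lt_iff_lt_coe h.1.le).2 h.2
    rw [Set.indicator_of_mem (show s ∈ Set.Ioo 0 (t : ℝ) from h), Set.indicator_of_mem (by exact h)]
    simp [evalBefore, h']
  · rw [Set.indicator_of_notMem (by exact h), Set.indicator_of_notMem (by exact h)]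

theorem isStronglyPredictable_integrated (h : IsStronglyPredictable natFiltration ydot) :
    IsStronglyPredictable natFiltration (fun t ω => integrated ydot ω t) := by
  let : MeasurableSpace (ℝ≥0 × Config) := natFiltration.predictable
  refine Measurable.stronglyMeasurable ?_
  have h1 : Measurable ({q : ℝ × (ℝ≥0 × Config) | 0 < q.1 ∧ q.1 < q.2.1}.indicator
      (fun q => ENNReal.ofReal (Function.uncurry ydot (evalBefore q)))) := by
    refine Measurable.indicator
      (ENNReal.measurable_ofReal.comp (h.measurable.comp measurable_evalBefore)) ?_
    refine (measurableSet_lt measurable_const measurable_fst).inter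
      (measurableSet_lt measurable_fst ?_)
    exact measurable_coe_nnreal_real.comp (measurable_predictable_fst.comp measurable_snd)
  have h2 := h1.lintegral_prod_left' (μ := (volume : Measure ℝ))
  convert h2 using 1
  ext p
  exact integrated_eq_lintegral_evalBefore ydot p

theorem measurable_uncurry_integrated (h : IsStronglyPredictable natFiltration ydot) :
    Measurable fun p : ℝ≥0 × Config => integrated ydot p.2 p.1 :=
  (isStronglyPredictable_integrated h).measurable.mono predictable_le_prod le_rfl

theorem measurable_section (h : IsStronglyPredictable natFiltration ydot) (ω : Config) :
    Measurable fun s => ydot s ω :=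
  (h.measurable.mono predictable_le_prod le_rfl).comp measurable_prodMk_right

/-- Lebesgue measure does not charge `{t}`, so only times before `t` matter. The strict inequality
in `hag` is what the first-difference argument in `Solves.agreeUpTo` needs. -/
theorem integrated_congr (h : IsStronglyPredictable natFiltration ydot) {ω ω' : Config} {t : ℝ≥0}
    (hag : ∀ u < t, count ω u = count ω' u) : integrated ydot ω t = integrated ydot ω' t := by
  rw [integrated, integrated, ← restrict_Ioo_eq_restrict_Ioc]
  refine setLIntegral_congr_fun measurableSet_Ioo fun s hs => ?_
  have hst : s.toNNReal < t := (Real.toNNReal_lt_iff_lt_coe hs.1.le).2 hs.2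
  have hag' : AgreeUpTo s.toNNReal ω ω' := fun u hu => hag u (hu.trans_lt hst)
  simp only [hag'.eq_of_measurable (h.stronglyAdapted s.toNNReal).measurable]

theorem integrated_zero (ydot : ℝ≥0 → Config → ℝ) (ω : Config) : integrated ydot ω 0 = 0 := by
  simp [integrated]

theorem integrated_mono (ydot : ℝ≥0 → Config → ℝ) (ω : Config) :
    Monotone (integrated ydot ω) := fun _ _ hst =>
  lintegral_mono_set (Set.Ioc_subset_Ioc_right (NNReal.coe_le_coe.2 hst))

/-! ### Regular paths and inversion of the time change -/

/-- The path `y` is finite and is given by the increasing homeomorphism `f` of `[0, ∞)`. -/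
structure IsRegularPath (y : ℝ≥0 → ℝ≥0∞) (f : ℝ≥0 → ℝ≥0) : Prop where
  eq_coe : ∀ t, y t = f t
  continuous : Continuous f
  strictMono : StrictMono f
  zero : f 0 = 0
  surjective : Function.Surjective f

theorem exists_isRegularPath {ω : Config} (hm : Measurable fun s => ydot s ω)
    (hpos : ∀ s, 0 < ydot s ω) (hfin : ∀ t, integrated ydot ω t < ∞)
    (htop : Tendsto (integrated ydot ω) atTop (𝓝 ∞)) :
    ∃ f, IsRegularPath (integrated ydot ω) f := by
  -- The cut-off at `0` reduces integrability over arbitrary real intervals to `hint`.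
  let g : ℝ → ℝ := (Set.Ioi 0).indicator fun s => ydot s.toNNReal ω
  have hgm : Measurable fun s : ℝ => ydot s.toNNReal ω := hm.comp measurable_real_toNNReal
  have hint : ∀ t : ℝ≥0, IntegrableOn (fun s : ℝ => ydot s.toNNReal ω) (Set.Ioc 0 t) := by
    intro t
    refine ⟨hgm.aestronglyMeasurable, ?_⟩
    rw [hasFiniteIntegral_iff_ofReal (Eventually.of_forall fun s => (hpos _).le)]
    exact hfin t
  have hgint : ∀ a b, IntervalIntegrable g volume a b := by
    intro a b
    rw [intervalIntegrable_iff]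
    have h1 : IntegrableOn g (Set.Iic (max a b).toNNReal) := by
      have h2 := hint (max a b).toNNReal
      rw [← Set.Ioi_inter_Iic,
        ← integrable_indicator_iff (measurableSet_Ioi.inter measurableSet_Iic), Set.inter_comm,
        ← Set.indicator_indicator, integrable_indicator_iff measurableSet_Iic] at h2
      exact h2
    refine h1.mono_set fun x hx => ?_
    exact (hx.2 : x ≤ max a b).trans (Real.le_coe_toNNReal _)
  let F : ℝ → ℝ := fun t => ∫ s in (0 : ℝ)..t, g s
  have hFc : Continuous F := intervalIntegral.continuous_primitive hgint 0
  have hgnn : ∀ s, 0 ≤ g s := fun s => Set.indicator_nonneg (fun _ _ => (hpos _).le) s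
  have hFnn : ∀ t : ℝ≥0, 0 ≤ F t := fun t =>
    intervalIntegral.integral_nonneg t.coe_nonneg fun s _ => hgnn s
  have hFs : ∀ a b : ℝ≥0, a < b → F a < F b := by
    intro a b hab
    have h1 : F b - F a = ∫ s in (a : ℝ)..b, g s :=
      intervalIntegral.integral_interval_sub_left (hgint _ _) (hgint _ _)
    have h2 : 0 < ∫ s in (a : ℝ)..b, g s := by
      refine intervalIntegral.intervalIntegral_pos_of_pos_on (hgint _ _) (fun s hs => ?_)
        (NNReal.coe_lt_coe.2 hab)
      have : s ∈ Set.Ioi (0 : ℝ) := lt_of_le_of_lt a.2 hs.1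
      simp only [g, Set.indicator_of_mem this, hpos]
    linarith
  have hF : ∀ t : ℝ≥0, integrated ydot ω t = ENNReal.ofReal (F t) := by
    intro t
    have h1 : F t = ∫ s in Set.Ioc (0 : ℝ) t, ydot s.toNNReal ω := by
      change ∫ s in (0 : ℝ)..t, g s = _
      rw [intervalIntegral.integral_of_le t.coe_nonneg]
      refine setIntegral_congr_fun measurableSet_Ioc fun s hs => ?_
      simp only [g, Set.indicator_of_mem (show s ∈ Set.Ioi (0 : ℝ) from hs.1)]
    rw [h1, ofReal_integral_eq_lintegral_ofReal (hint t)
      (Eventually.of_forall fun s => (hpos _).le)]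
    rfl
  let f : ℝ≥0 → ℝ≥0 := fun t => (F t).toNNReal
  have hy : ∀ t, integrated ydot ω t = f t := fun t => hF t
  have hfc : Continuous f := continuous_real_toNNReal.comp (hFc.comp NNReal.continuous_coe)
  have hf0 : f 0 = 0 := by simp [f, F]
  refine ⟨f, hy, hfc, fun a b hab => ?_, hf0, fun c => ?_⟩
  · exact (Real.toNNReal_lt_toNNReal_iff_of_nonneg (hFnn a)).2 (hFs a b hab)
  · obtain ⟨b, hb⟩ := (htop.eventually (lt_mem_nhds (ENNReal.coe_lt_top (r := c)))).exists
    rw [hy, ENNReal.coe_lt_coe] at hb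
    have := intermediate_value_Icc (zero_le (a := b)) hfc.continuousOn
    obtain ⟨x, -, hx⟩ := this ⟨hf0.le.trans zero_le, hb.le⟩
    exact ⟨x, hx⟩

theorem IsPosPredictable.ae_exists_isRegularPath {π : Measure Config}
    (hy : IsPosPredictable π ydot) : ∀ᵐ ω ∂π, ∃ f, IsRegularPath (integrated ydot ω) f := by
  have h : ∀ᵐ ω ∂π, ∀ n : ℕ, integrated ydot ω n < ∞ := ae_all_iff.2 fun n => hy.finite n
  filter_upwards [h, hy.tendsto] with ω h1 h2
  refine exists_isRegularPath (measurable_section hy.predictable ω) (fun s => hy.pos s ω)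
    (fun t => ?_) h2
  obtain ⟨n, hn⟩ := exists_nat_ge t
  exact (integrated_mono ydot ω hn).trans_lt (h1 n)

theorem IsRegularPath.rightInverse_apply {y : ℝ≥0 → ℝ≥0∞} {f : ℝ≥0 → ℝ≥0}
    (h : IsRegularPath y f) (s : ℝ≥0) : rightInverse y (f s) = s := by
  refine le_antisymm ?_ ?_
  · refine le_of_forall_gt fun c hc => ?_
    obtain ⟨u, hsu, huc⟩ := ENNReal.lt_iff_exists_nnreal_btwn.1 hc
    refine lt_of_le_of_lt (iInf₂_le u ?_) huc
    rw [h.eq_coe, ENNReal.coe_lt_coe]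
    exact h.strictMono (ENNReal.coe_lt_coe.1 hsu)
  · refine le_iInf₂ fun u hu => ?_
    rw [h.eq_coe, ENNReal.coe_lt_coe] at hu
    exact ENNReal.coe_le_coe.2 (h.strictMono.lt_iff_lt.1 hu).le

theorem IsTimeChanged.unique {f : ℝ≥0 → ℝ≥0∞} {ω ω₁ ω₂ : Config} (h₁ : IsTimeChanged f ω ω₁)
    (h₂ : IsTimeChanged f ω ω₂) : ω₁ = ω₂ :=
  Config.ext_count fun t => by exact_mod_cast (h₁ t).trans (h₂ t).symm

theorem timeChange_eq {η : Config → ℝ≥0 → ℝ≥0∞} {ω ω' : Config}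
    (h : IsTimeChanged (η ω) ω ω') : timeChange η ω = ω' := by
  have hex : ∃ ω', IsTimeChanged (η ω) ω ω' := ⟨ω', h⟩
  rw [timeChange, dif_pos hex]
  exact hex.choose_spec.unique h

theorem IsRegularPath.isTimeChanged_iff {y : ℝ≥0 → ℝ≥0∞} {f : ℝ≥0 → ℝ≥0}
    (h : IsRegularPath y f) {ω z : Config} :
    IsTimeChanged y ω z ↔ ∀ t, count z t = count ω (f t) := by
  refine forall_congr' fun t => ?_
  rw [h.eq_coe, countE_coe]
  norm_cast

/-- Every time is of the form `f t`, and the right inverse takes it back to `t`, so the two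
equations are the same after substitution. -/
theorem IsRegularPath.isTimeChanged_rightInverse_iff {y : ℝ≥0 → ℝ≥0∞} {f : ℝ≥0 → ℝ≥0}
    (h : IsRegularPath y f) {ω z : Config} :
    IsTimeChanged (rightInverse y) z ω ↔ IsTimeChanged y ω z := by
  rw [h.isTimeChanged_iff, IsTimeChanged, h.surjective.forall]
  refine forall_congr' fun t => ?_
  rw [h.rightInverse_apply, countE_coe, eq_comm]
  norm_cast

/-- The atoms are moved by `f`. Existence keeps `timeChange` away from its irrelevant default
branch. -/
theorem IsRegularPath.exists_isTimeChanged {y : ℝ≥0 → ℝ≥0∞} {f : ℝ≥0 → ℝ≥0}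
    (h : IsRegularPath y f) (z : Config) : ∃ ω, IsTimeChanged (rightInverse y) z ω := by
  have hinter : ∀ t, f '' z.carrier ∩ Set.Iic (f t) = f '' (z.carrier ∩ Set.Iic t) := by
    intro t
    ext x
    constructor
    · rintro ⟨⟨u, hu, rfl⟩, hx⟩
      exact ⟨u, ⟨hu, h.strictMono.le_iff_le.1 hx⟩, rfl⟩
    · rintro ⟨u, ⟨hu, hut⟩, rfl⟩
      exact ⟨⟨u, hu, rfl⟩, h.strictMono.le_iff_le.2 hut⟩
  let ω : Config :=
    { carrier := f '' z.carrier
      zero_notMem := by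
        rintro ⟨u, hu, h0⟩
        rw [← h.zero] at h0
        exact z.zero_notMem (h.strictMono.injective h0 ▸ hu)
      finite_Iic := by
        refine h.surjective.forall.2 fun t => ?_
        rw [hinter]
        exact (z.finite_Iic t).image f
      infinite := z.infinite.image h.strictMono.injective.injOn }
  refine ⟨ω, h.isTimeChanged_rightInverse_iff.2 (h.isTimeChanged_iff.2 fun t => ?_)⟩
  rw [count, count, hinter, Set.ncard_image_of_injective _ h.strictMono.injective]

theorem IsRegularPath.mapY_eq_iff {f : ℝ≥0 → ℝ≥0} {ω z : Config}
    (h : IsRegularPath (integrated ydot z) f) :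
    mapY ydot z = ω ↔ IsTimeChanged (integrated ydot z) ω z := by
  obtain ⟨ω', hω'⟩ := h.exists_isTimeChanged z
  have h1 : mapY ydot z = ω' := timeChange_eq hω'
  rw [← h.isTimeChanged_rightInverse_iff, h1]
  exact ⟨fun e => e ▸ hω', fun e => hω'.unique e⟩

/-! ### The Hawkes equation does not anticipate -/

/-- `z` solves the Hawkes equation `z(t) = ω(y(z, t))` driven by `ω`, and the path `y(z, ·)` is the
increasing homeomorphism `f`. -/
structure Solves (ydot : ℝ≥0 → Config → ℝ) (ω z : Config) (f : ℝ≥0 → ℝ≥0) : Prop where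
  path : IsRegularPath (integrated ydot z) f
  count_eq : ∀ t, count z t = count ω (f t)

/-- Counting functions are locally constant to the right, so the infimum of the times of
disagreement is itself one. -/
theorem exists_first_difference {z z' : Config} {t : ℝ≥0} (h : ¬ AgreeUpTo t z z') :
    ∃ u ≤ t, count z u ≠ count z' u ∧ ∀ v < u, count z v = count z' v := by
  simp only [AgreeUpTo, not_forall] at h
  obtain ⟨u, hut, hu⟩ := h
  set S : Set ℝ≥0 := {u | count z u ≠ count z' u} with hS
  have hne : S.Nonempty := ⟨u, hu⟩
  refine ⟨sInf S, (csInf_le (OrderBot.bddBelow S) hu).trans hut, fun h => ?_, fun v hv => ?_⟩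
  · obtain ⟨v, hv, hc⟩ := exists_count_eq_right z (sInf S)
    obtain ⟨v', hv', hc'⟩ := exists_count_eq_right z' (sInf S)
    obtain ⟨w, hw, hwv⟩ := exists_lt_of_csInf_lt hne (lt_min hv hv')
    have hle : sInf S ≤ w := csInf_le (OrderBot.bddBelow S) hw
    refine hw ?_
    rw [hc w hle (hwv.trans_le (min_le_left _ _)), hc' w hle (hwv.trans_le (min_le_right _ _)), h]
  · by_contra hne'
    exact hv.not_ge (csInf_le (OrderBot.bddBelow S) hne')

/-- At a first difference `u` the two clocks still coincide, since they read the solutions before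
`u` only. Both counts at `u` are then counts of `ω` and `ω'` at the same time, at most `r`, and so
are equal. Only the clock of `z` needs to be bounded by `r`. -/
theorem Solves.agreeUpTo (hp : IsStronglyPredictable natFiltration ydot) {ω ω' z z' : Config}
    {f f' : ℝ≥0 → ℝ≥0} (h : Solves ydot ω z f) (h' : Solves ydot ω' z' f') {r t : ℝ≥0}
    (hag : AgreeUpTo r ω ω') (ht : f t ≤ r) : AgreeUpTo t z z' := by
  by_contra hne
  obtain ⟨u, hut, hu, hlt⟩ := exists_first_difference hne
  refine hu ?_
  have hy := integrated_congr hp hlt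
  rw [h.path.eq_coe, h'.path.eq_coe, ENNReal.coe_inj] at hy
  rw [h.count_eq, h'.count_eq, ← hy]
  exact hag _ ((h.path.strictMono.monotone hut).trans ht)

theorem Solves.path_eq (hp : IsStronglyPredictable natFiltration ydot) {ω ω' z z' : Config}
    {f f' : ℝ≥0 → ℝ≥0} (h : Solves ydot ω z f) (h' : Solves ydot ω' z' f') {r t : ℝ≥0}
    (hag : AgreeUpTo r ω ω') (ht : f t ≤ r) : f' t = f t := by
  have hy := integrated_congr hp fun u (hu : u < t) => h.agreeUpTo hp h' hag ht u hu.le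
  rw [h.path.eq_coe, h'.path.eq_coe, ENNReal.coe_inj] at hy
  exact hy.symm

theorem Solves.path_jumpTime {ω z : Config} {f : ℝ≥0 → ℝ≥0} (h : Solves ydot ω z f) (q : ℕ) :
    f (jumpTime q z) = jumpTime q ω := by
  have hiff : ∀ t, jumpTime q z ≤ t ↔ jumpTime q ω ≤ f t := fun t => by
    rw [jumpTime_le_iff, jumpTime_le_iff, h.count_eq]
  obtain ⟨u, hu⟩ := h.path.surjective (jumpTime q ω)
  refine le_antisymm ?_ ((hiff _).1 le_rfl)
  rw [← hu]
  exact h.path.strictMono.monotone ((hiff u).2 hu.ge)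

/-! ### Right inverses and generalized Hawkes processes -/

theorem ae_comp_of_map_absolutelyContinuous {π : Measure Config} {Z : Config → Config}
    (hZ : Measurable Z) (hac : π.map Z ≪ π) {P : Config → Prop} (h : ∀ᵐ ω ∂π, P ω) :
    ∀ᵐ ω ∂π, P (Z ω) :=
  ae_of_ae_map hZ.aemeasurable (hac.ae_le h)

theorem measurable_integrated_comp (hp : IsStronglyPredictable natFiltration ydot)
    {Z : Config → Config} (hZ : Measurable Z) (t : ℝ≥0) :
    Measurable fun ω => integrated ydot (Z ω) t :=
  (measurable_uncurry_integrated hp).comp (measurable_const.prodMk hZ)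

theorem isStopping_of_ae_solves {π : Measure Config} (hπ : IsUnitPoisson π)
    (hp : IsStronglyPredictable natFiltration ydot) {Z : Config → Config} (hZ : Measurable Z)
    (h : ∀ᵐ ω ∂π, ∃ f, Solves ydot ω (Z ω) f) (t : ℝ≥0) :
    IsStopping π (fun ω => integrated ydot (Z ω) t) := by
  intro s
  refine hπ.eventuallyMeasurableSet
    (measurableSet_le (measurable_integrated_comp hp hZ t) measurable_const) h ?_
  rintro ω ω' ⟨f, hf⟩ ⟨f', hf'⟩ hag hω
  simp only [Set.mem_ofPred_eq] at hω ⊢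
  rw [hf.path.eq_coe, ENNReal.coe_le_coe] at hω
  rw [hf'.path.eq_coe, hf.path_eq hp hf' hag hω, ENNReal.coe_le_coe]
  exact hω

theorem IsRightInverse.isGHawkesProcess {π : Measure Config} (hπ : IsUnitPoisson π)
    (hy : IsPosPredictable π ydot) {Z : Config → Config}
    (h : IsRightInverse π (mapY ydot) Z) : IsGHawkesProcess π ydot Z := by
  have hreg := ae_comp_of_map_absolutelyContinuous h.measurable h.absolutelyContinuous
    hy.ae_exists_isRegularPath
  have heq : ∀ᵐ ω ∂π, IsTimeChanged (integrated ydot (Z ω)) ω (Z ω) := by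
    filter_upwards [hreg, h.comp_eq] with ω ⟨f, hf⟩ hω
    exact hf.mapY_eq_iff.1 hω
  refine ⟨h.measurable, h.absolutelyContinuous, heq,
    isStopping_of_ae_solves hπ hy.predictable h.measurable ?_⟩
  filter_upwards [hreg, heq] with ω ⟨f, hf⟩ hω
  exact ⟨f, hf, hf.isTimeChanged_iff.1 hω⟩

theorem IsGHawkesProcess.ae_solves {π : Measure Config} (hy : IsPosPredictable π ydot)
    {Z : Config → Config} (h : IsGHawkesProcess π ydot Z) :
    ∀ᵐ ω ∂π, ∃ f, Solves ydot ω (Z ω) f := by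
  filter_upwards [h.equation, ae_comp_of_map_absolutelyContinuous h.measurable
    h.absolutelyContinuous hy.ae_exists_isRegularPath] with ω hω ⟨f, hf⟩
  exact ⟨f, hf, hf.isTimeChanged_iff.1 hω⟩

theorem IsGHawkesProcess.isRightInverse {π : Measure Config} (hy : IsPosPredictable π ydot)
    {Z : Config → Config} (h : IsGHawkesProcess π ydot Z) : IsRightInverse π (mapY ydot) Z := by
  refine ⟨h.measurable, h.absolutelyContinuous, ?_⟩
  filter_upwards [h.equation, h.ae_solves hy] with ω hω ⟨f, hf⟩
  exact hf.path.mapY_eq_iff.2 hω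

theorem IsRegularPath.continuousWithinAt {y : ℝ≥0 → ℝ≥0∞} {f : ℝ≥0 → ℝ≥0}
    (h : IsRegularPath y f) (s : Set ℝ≥0) (t : ℝ≥0) : ContinuousWithinAt y s t := by
  rw [show y = fun t => (f t : ℝ≥0∞) from funext h.eq_coe]
  exact (ENNReal.continuous_coe.comp h.continuous).continuousWithinAt

theorem IsGHawkesProcess.isChangeOfTime {π : Measure Config} (hy : IsPosPredictable π ydot)
    {Z : Config → Config} (h : IsGHawkesProcess π ydot Z) :
    IsChangeOfTime π (fun ω => integrated ydot (Z ω)) where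
  zero := Eventually.of_forall fun ω => integrated_zero ydot (Z ω)
  monotone := Eventually.of_forall fun ω => integrated_mono ydot (Z ω)
  rightContinuous := by
    filter_upwards [h.ae_solves hy] with ω ⟨f, hf⟩ t
    exact hf.path.continuousWithinAt _ t
  finite := by
    filter_upwards [h.ae_solves hy] with ω ⟨f, hf⟩ t
    rw [hf.path.eq_coe]
    exact ENNReal.coe_lt_top
  tendsto := ae_comp_of_map_absolutelyContinuous h.measurable h.absolutelyContinuous hy.tendsto
  stopping t _ := h.stopping t

/-! ### Optional stopping for the compensated Poisson process -/

theorem hasSum_id_poissonMeasure (r : ℝ≥0) :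
    HasSum (fun n : ℕ => (Real.exp (-r) * r ^ n / n.factorial) * (n : ℝ)) r := by
  have h := (hasSum_one_poissonMeasure r).mul_left (r : ℝ)
  rw [mul_one] at h
  -- The term at `0` vanishes, and the shifted series is `r` times the total Poisson mass.
  rw [← hasSum_nat_add_iff' 1]
  simp only [Finset.range_one, Finset.sum_singleton, Nat.cast_zero, mul_zero, sub_zero]
  refine Eq.mpr (congrArg (fun g => HasSum g (r : ℝ)) (funext fun n => ?_)) h
  rw [Nat.factorial_succ, pow_succ]
  push_cast
  field_simp

/-- The compensated Poisson process `N(t) - t`. -/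
noncomputable def compensated (ω : Config) (t : ℝ≥0) : ℝ := (count ω t : ℝ) - t

theorem measurable_compensated {τ : Config → ℝ≥0} (hτ : Measurable τ) :
    Measurable fun ω => compensated ω (τ ω) :=
  ((measurable_from_top (f := fun n : ℕ => (n : ℝ))).comp
    (measurable_uncurry_count.comp (hτ.prodMk measurable_id))).sub
    (measurable_coe_nnreal_real.comp hτ)

theorem abs_compensated_le {ω : Config} {t : ℝ≥0} {c d : ℝ} (h : (count ω t : ℝ) ≤ c)
    (h' : (t : ℝ) ≤ d) : |compensated ω t| ≤ c + d := by
  have h1 : (0 : ℝ) ≤ count ω t := Nat.cast_nonneg _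
  have h2 := t.coe_nonneg
  rw [compensated, abs_le]
  constructor <;> linarith

theorem IsUnitPoisson.integral_increment {π : Measure Config} (hπ : IsUnitPoisson π)
    {s t : ℝ≥0} (h : s ≤ t) :
    Integrable (fun ω => ((count ω t - count ω s : ℕ) : ℝ)) π ∧
      ∫ ω, ((count ω t - count ω s : ℕ) : ℝ) ∂π = (t - s : ℝ≥0) := by
  have hm : Measurable fun ω : Config => count ω t - count ω s :=
    (measurable_count t).sub (measurable_count s)
  have hlaw := hπ.law_increments s t h
  have hi : Integrable (fun n : ℕ => (n : ℝ)) (poissonMeasure (t - s)) := by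
    rw [integrable_poissonMeasure_iff]
    simpa using (hasSum_id_poissonMeasure (t - s)).summable
  have hs := (hasSum_integral_poissonMeasure hi).unique (by
    simpa using hasSum_id_poissonMeasure (t - s))
  rw [← hlaw] at hi hs
  refine ⟨(integrable_map_measure hi.1 hm.aemeasurable).1 hi, ?_⟩
  rw [integral_map hm.aemeasurable hi.1] at hs
  exact hs

theorem IsUnitPoisson.integrable_count {π : Measure Config} (hπ : IsUnitPoisson π)
    (t : ℝ≥0) :
    Integrable (fun ω => (count ω t : ℝ)) π := by
  simpa [count_zero] using (hπ.integral_increment (zero_le (a := t))).1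

theorem IsUnitPoisson.integrable_compensated {π : Measure Config} (hπ : IsUnitPoisson π) (t : ℝ≥0) :
    Integrable (fun ω => compensated ω t) π := by
  have := hπ.isProbabilityMeasure
  exact (hπ.integrable_count t).sub (integrable_const _)

theorem IsUnitPoisson.setIntegral_compensated {π : Measure Config} (hπ : IsUnitPoisson π)
    {s t : ℝ≥0} (h : s ≤ t) {B : Set Config}
    (hB : EventuallyMeasurableSet (natFiltration s) (ae π) B) :
    ∫ ω in B, compensated ω t ∂π = ∫ ω in B, compensated ω s ∂π := by
  have := hπ.isProbabilityMeasure
  obtain ⟨C, hC, hBC⟩ := hB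
  rw [setIntegral_congr_set hBC, setIntegral_congr_set hBC]
  obtain ⟨hi, hint⟩ := hπ.integral_increment h
  have hle : MeasurableSpace.comap (fun ω : Config => count ω t - count ω s) ⊤ ≤
      (inferInstance : MeasurableSpace Config) :=
    ((measurable_count t).sub (measurable_count s)).comap_le
  have hce := condExp_indep_eq hle (natFiltration.le s)
    (f := fun ω => ((count ω t - count ω s : ℕ) : ℝ))
    ((measurable_from_top (f := fun n : ℕ => (n : ℝ))).comp
      (comap_measurable _)).stronglyMeasurable (hπ.indep_increments s t h)
  have h1 := setIntegral_condExp (natFiltration.le s) hi hC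
  rw [setIntegral_congr_ae (natFiltration.le s _ hC) (hce.mono fun ω hω _ => hω), hint] at h1
  rw [← sub_eq_zero, ← integral_sub (hπ.integrable_compensated t).integrableOn
    (hπ.integrable_compensated s).integrableOn]
  have h2 : ∀ ω, compensated ω t - compensated ω s =
      ((count ω t - count ω s : ℕ) : ℝ) - (t - s : ℝ≥0) := by
    intro ω
    rw [compensated, compensated, Nat.cast_sub (count_mono ω h), NNReal.coe_sub h]
    ring
  simp only [h2]
  rw [integral_sub hi.integrableOn (integrable_const _).integrableOn, ← h1, sub_self]

theorem IsUnitPoisson.integrable_compensated_of_le {π : Measure Config} (hπ : IsUnitPoisson π)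
    {τ : Config → ℝ≥0} (hτ : Measurable τ) {K : ℝ≥0} (hK : ∀ ω, τ ω ≤ K) :
    Integrable (fun ω => compensated ω (τ ω)) π := by
  have := hπ.isProbabilityMeasure
  refine ((hπ.integrable_count K).add (integrable_const (K : ℝ))).mono'
    (measurable_compensated hτ).aestronglyMeasurable (Eventually.of_forall fun ω => ?_)
  exact abs_compensated_le (Nat.cast_le.2 (count_mono ω (hK ω))) (NNReal.coe_le_coe.2 (hK ω))

/-- On each piece where the time equals `d j`, this is the martingale property between `d j` and
`K`. -/
theorem IsUnitPoisson.optional_stopping_of_countable {π : Measure Config} (hπ : IsUnitPoisson π)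
    {K : ℝ≥0} {A : Set Config}
    (hA : MeasurableSet A) {σ : Config → ℕ} (hσ : Measurable σ) {d : ℕ → ℝ≥0} (hd : ∀ j, d j ≤ K)
    (h : ∀ j, EventuallyMeasurableSet (natFiltration (d j)) (ae π) (A ∩ σ ⁻¹' {j})) :
    ∫ ω in A, compensated ω (d (σ ω)) ∂π = ∫ ω in A, compensated ω K ∂π := by
  have hunion : A = ⋃ j, A ∩ σ ⁻¹' {j} := by
    rw [← Set.inter_iUnion, ← Set.preimage_iUnion, Set.iUnion_of_singleton, Set.preimage_univ,
      Set.inter_univ]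
  have hm : ∀ j, MeasurableSet (A ∩ σ ⁻¹' {j}) := fun j => hA.inter (hσ (measurableSet_singleton j))
  have hdis : Pairwise (Function.onFun Disjoint fun j => A ∩ σ ⁻¹' {j}) := by
    intro i j hij
    refine Set.disjoint_left.2 ?_
    rintro ω ⟨-, h1⟩ ⟨-, h2⟩
    exact hij (h1.symm.trans h2)
  have hi := hπ.integrable_compensated_of_le ((measurable_from_top (f := d)).comp hσ)
    (fun ω => hd (σ ω))
  simp only [Function.comp_apply] at hi
  rw [hunion, integral_iUnion hm hdis hi.integrableOn,
    integral_iUnion hm hdis (hπ.integrable_compensated K).integrableOn]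
  refine tsum_congr fun j => ?_
  rw [hπ.setIntegral_compensated (hd j) (h j)]
  refine setIntegral_congr_fun (hm j) fun ω hω => ?_
  have : σ ω = j := hω.2
  simp only [this]

/-- The time is approximated from above by values in grids of mesh `1 / (n + 1)` capped at `K`;
right-continuity and domination by `N(K) + K` give the limit. Measurability is asked on `A` only, so
`τ` need not be a stopping time off `A`. -/
theorem IsUnitPoisson.optional_stopping {π : Measure Config} (hπ : IsUnitPoisson π)
    {K : ℝ≥0} {A : Set Config}
    (hA : MeasurableSet A) {τ : Config → ℝ≥0} (hτ : Measurable τ) (hK : ∀ ω, τ ω ≤ K)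
    (h : ∀ r, EventuallyMeasurableSet (natFiltration r) (ae π) (A ∩ {ω | τ ω ≤ r})) :
    ∫ ω in A, compensated ω (τ ω) ∂π = ∫ ω in A, compensated ω K ∂π := by
  have := hπ.isProbabilityMeasure
  let d : ℕ → ℕ → ℝ≥0 := fun n j => min ((j : ℝ≥0) / (n + 1)) K
  let σ : ℕ → Config → ℕ := fun n ω => ⌈(n + 1) * τ ω⌉₊
  have hn : ∀ n : ℕ, (0 : ℝ≥0) < n + 1 := fun n => by positivity
  have hσ : ∀ n, Measurable (σ n) := fun n => Nat.measurable_ceil.comp (hτ.const_mul _)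
  have hσ_le : ∀ n j ω, σ n ω ≤ j ↔ τ ω ≤ d n j := by
    -- The cap at `K` in `d` costs nothing here because `τ ≤ K`.
    intro n j ω
    rw [Nat.ceil_le, le_min_iff, le_div_iff₀' (hn n), and_iff_left (hK ω)]
  have hmono : ∀ n, Monotone (d n) := fun n i j hij =>
    min_le_min_right _ (by gcongr)
  have hmeas : ∀ n j, EventuallyMeasurableSet (natFiltration (d n j)) (ae π)
      (A ∩ σ n ⁻¹' {j}) := by
    intro n j
    have hle : ∀ i ≤ j, EventuallyMeasurableSet (natFiltration (d n j)) (ae π)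
        (A ∩ {ω | σ n ω ≤ i}) := by
      intro i hij
      simp only [hσ_le]
      obtain ⟨C, hC, hAC⟩ := h (d n i)
      exact ⟨C, natFiltration.mono (hmono n hij) _ hC, hAC⟩
    cases j with
    | zero =>
      convert hle 0 le_rfl using 2
      ext ω
      simp
    | succ j =>
      have : A ∩ σ n ⁻¹' {j + 1} = (A ∩ {ω | σ n ω ≤ j + 1}) \ (A ∩ {ω | σ n ω ≤ j}) := by
        ext ω
        simp only [Set.mem_inter_iff, Set.mem_preimage, Set.mem_singleton_iff, Set.mem_sdiff,
          Set.mem_ofPred_eq]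
        constructor
        · rintro ⟨h1, h2⟩
          exact ⟨⟨h1, h2.le⟩, fun h3 => by omega⟩
        · rintro ⟨⟨h1, h2⟩, h3⟩
          exact ⟨h1, by by_contra h4; exact h3 ⟨h1, by omega⟩⟩
      rw [this]
      exact MeasurableSet.diff (hle (j + 1) le_rfl) (hle j (Nat.le_succ j))
  have hopt : ∀ n, ∫ ω in A, compensated ω (d n (σ n ω)) ∂π = ∫ ω in A, compensated ω K ∂π :=
    fun n => hπ.optional_stopping_of_countable hA (hσ n) (fun j => min_le_right _ _) (hmeas n)
  refine tendsto_nhds_unique (f := fun n : ℕ => ∫ ω in A, compensated ω (d n (σ n ω)) ∂π)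
    (l := atTop) ?_ (by simp only [hopt]; exact tendsto_const_nhds)
  refine tendsto_integral_of_dominated_convergence (fun ω => (count ω K : ℝ) + K)
    (fun n => (measurable_compensated
      ((measurable_from_top (f := d n)).comp (hσ n))).aestronglyMeasurable)
    ((hπ.integrable_count K).add (integrable_const (K : ℝ))).integrableOn
    (fun n => Eventually.of_forall fun ω => ?_) (Eventually.of_forall fun ω => ?_)
  · have hdK : d n (σ n ω) ≤ K := min_le_right _ _
    exact abs_compensated_le (Nat.cast_le.2 (count_mono ω hdK)) (NNReal.coe_le_coe.2 hdK)
  · have hge : ∀ n, τ ω ≤ d n (σ n ω) := fun n => (hσ_le n _ ω).1 le_rfl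
    have hle : ∀ n : ℕ, d n (σ n ω) ≤ τ ω + 1 / (n + 1) := by
      intro n
      refine (min_le_left _ _).trans ?_
      rw [div_le_iff₀' (hn n), mul_add, mul_one_div_cancel (hn n).ne']
      exact (Nat.ceil_lt_add_one zero_le).le
    have hd : Tendsto (fun n => d n (σ n ω)) atTop (𝓝 (τ ω)) := by
      refine tendsto_of_tendsto_of_tendsto_of_le_of_le tendsto_const_nhds ?_ hge hle
      have : Tendsto (fun n : ℕ => (1 : ℝ≥0) / (n + 1)) atTop (𝓝 0) :=
        tendsto_one_div_add_atTop_nhds_zero_nat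
      simpa using this.const_add (τ ω)
    obtain ⟨v, hv, hc⟩ := exists_count_eq_right ω (τ ω)
    refine Tendsto.sub ?_ ((NNReal.continuous_coe.tendsto _).comp hd)
    refine tendsto_const_nhds.congr' ?_
    filter_upwards [hd.eventually (gt_mem_nhds hv)] with n hn
    rw [hc _ (hge n) hn]

variable {π : Measure Config}

/-- Optional stopping equates the mean of `T_q ∧ K` with that of `N(T_q ∧ K)`, which never exceeds
`q`. -/
theorem IsUnitPoisson.integral_min_jumpTime_le (hπ : IsUnitPoisson π) (q : ℕ) (K : ℝ≥0) :
    ∫ ω, ((min (jumpTime q ω) K : ℝ≥0) : ℝ) ∂π ≤ q := by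
  have := hπ.isProbabilityMeasure
  have hτ : Measurable fun ω => min (jumpTime q ω) K := (measurable_jumpTime q).min measurable_const
  have h0 : ∫ ω, compensated ω K ∂π = 0 := by
    have h := hπ.setIntegral_compensated (zero_le (a := K)) (B := Set.univ)
      (@MeasurableSet.univ _ (natFiltration 0)).eventuallyMeasurableSet
    simpa [compensated, count_zero] using h
  have h1 := hπ.optional_stopping (A := Set.univ) MeasurableSet.univ hτ
    (fun ω => min_le_right _ _) fun r => by
      rw [Set.univ_inter]
      refine MeasurableSet.eventuallyMeasurableSet ?_
      have : {ω | min (jumpTime q ω) K ≤ r} =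
          (fun ω => count ω r) ⁻¹' {n | q ≤ n ∨ K ≤ r} := by
        ext ω
        simp [jumpTime_le_iff]
      rw [this]
      exact measurable_natFiltration_count le_rfl (Set.to_countable _).measurableSet
  simp only [Measure.restrict_univ, h0] at h1
  have hiτ : Integrable (fun ω => ((min (jumpTime q ω) K : ℝ≥0) : ℝ)) π := by
    refine (integrable_const (K : ℝ)).mono'
      (measurable_coe_nnreal_real.comp hτ).aestronglyMeasurable (Eventually.of_forall fun ω => ?_)
    rw [Real.norm_of_nonneg (NNReal.coe_nonneg _)]
    exact NNReal.coe_le_coe.2 (min_le_right _ _)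
  have hi := hπ.integrable_compensated_of_le hτ (K := K) fun ω => min_le_right _ _
  have h2 : ∫ ω, (compensated ω (min (jumpTime q ω) K) + ((min (jumpTime q ω) K : ℝ≥0) : ℝ)) ∂π
      ≤ ∫ _, (q : ℝ) ∂π := by
    refine integral_mono (hi.add hiτ) (integrable_const _) fun ω => ?_
    rw [compensated, sub_add_cancel, min_comm, count_min_jumpTime]
    exact Nat.cast_le.2 (min_le_right _ _)
  rw [integral_add hi hiτ, h1, zero_add] at h2
  simpa using h2

theorem IsUnitPoisson.integrable_jumpTime (hπ : IsUnitPoisson π) (q : ℕ) :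
    Integrable (fun ω => (jumpTime q ω : ℝ)) π := by
  have := hπ.isProbabilityMeasure
  refine ⟨(measurable_coe_nnreal_real.comp (measurable_jumpTime q)).aestronglyMeasurable, ?_⟩
  rw [hasFiniteIntegral_iff_ofReal (Eventually.of_forall fun ω => NNReal.coe_nonneg _)]
  simp only [ENNReal.ofReal_coe_nnreal]
  have hm : ∀ n : ℕ, Measurable fun ω => min (jumpTime q ω) (n : ℝ≥0) := fun n =>
    (measurable_jumpTime q).min measurable_const
  have hlim : Tendsto (fun n : ℕ => ∫⁻ ω, ((min (jumpTime q ω) n : ℝ≥0) : ℝ≥0∞) ∂π) atTop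
      (𝓝 (∫⁻ ω, (jumpTime q ω : ℝ≥0∞) ∂π)) := by
    refine lintegral_tendsto_of_tendsto_of_monotone
      (fun n => (measurable_coe_nnreal_ennreal.comp (hm n)).aemeasurable)
      (Eventually.of_forall fun ω m n hmn => ?_) (Eventually.of_forall fun ω => ?_)
    · exact ENNReal.coe_le_coe.2 (min_le_min_left _ (Nat.cast_le.2 hmn))
    · refine tendsto_const_nhds.congr' ?_
      obtain ⟨m, hm⟩ := exists_nat_ge (jumpTime q ω)
      filter_upwards [eventually_ge_atTop m] with n hn
      rw [min_eq_left (hm.trans (Nat.cast_le.2 hn))]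
  refine lt_of_le_of_lt (le_of_tendsto' hlim fun n => ?_) (ENNReal.natCast_lt_top q)
  have hi : Integrable (fun ω => ((min (jumpTime q ω) n : ℝ≥0) : ℝ)) π := by
    refine (integrable_const (n : ℝ)).mono'
      (measurable_coe_nnreal_real.comp (hm n)).aestronglyMeasurable
      (Eventually.of_forall fun ω => ?_)
    rw [Real.norm_of_nonneg (NNReal.coe_nonneg _)]
    exact (NNReal.coe_le_coe.2 (min_le_right _ _)).trans_eq (NNReal.coe_natCast n)
  have h1 := ofReal_integral_eq_lintegral_ofReal hi
    (Eventually.of_forall fun ω => NNReal.coe_nonneg _)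
  simp only [ENNReal.ofReal_coe_nnreal] at h1
  rw [← h1]
  exact (ENNReal.ofReal_le_ofReal (hπ.integral_min_jumpTime_le q n)).trans_eq
    (ENNReal.ofReal_natCast q)

theorem abs_compensated_min_jumpTime_le (q : ℕ) (ω : Config) (u v : ℝ≥0) :
    |compensated ω (min (min u (jumpTime q ω)) v)| ≤ q + jumpTime q ω := by
  have h : min (min u (jumpTime q ω)) v ≤ jumpTime q ω := (min_le_left _ _).trans (min_le_right _ _)
  refine abs_compensated_le (Nat.cast_le.2 ?_) (NNReal.coe_le_coe.2 h)
  exact (count_mono ω h).trans (jumpTime_spec ω q).1.le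

/-! ### The compensator of a generalized Hawkes process -/

/-- The time `y(Z, t)`, as a finite time. -/
noncomputable def changedTime (ydot : ℝ≥0 → Config → ℝ) (Z : Config → Config) (t : ℝ≥0)
    (ω : Config) : ℝ≥0 := (integrated ydot (Z ω) t).toNNReal

theorem IsRegularPath.changedTime_eq {Z : Config → Config} {ω : Config} {f : ℝ≥0 → ℝ≥0}
    (h : IsRegularPath (integrated ydot (Z ω)) f) (t : ℝ≥0) : changedTime ydot Z t ω = f t := by
  rw [changedTime, h.eq_coe, ENNReal.toNNReal_coe]

theorem measurable_changedTime (hp : IsStronglyPredictable natFiltration ydot)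
    {Z : Config → Config} (hZ : Measurable Z) (t : ℝ≥0) : Measurable (changedTime ydot Z t) :=
  ENNReal.measurable_toNNReal.comp (measurable_integrated_comp hp hZ t)

/-- Optional stopping at the times `y(Z, s) ≤ y(Z, t)`, both localised at `T_q` and `K`. -/
theorem IsUnitPoisson.setIntegral_changedTime_bounded (hπ : IsUnitPoisson π)
    (hp : IsStronglyPredictable natFiltration ydot) {Z : Config → Config} (hZ : Measurable Z)
    (h : ∀ᵐ ω ∂π, ∃ f, Solves ydot ω (Z ω) f) {s t : ℝ≥0} (hst : s ≤ t) (q : ℕ) (K : ℝ≥0)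
    {A : Set Config} (hA : MeasurableSet[natFiltration s] A) :
    ∫ ω in Z ⁻¹' A ∩ {ω | changedTime ydot Z s ω ≤ min (jumpTime q ω) K},
        compensated ω (min (min (changedTime ydot Z t ω) (jumpTime q ω)) K) ∂π =
      ∫ ω in Z ⁻¹' A ∩ {ω | changedTime ydot Z s ω ≤ min (jumpTime q ω) K},
        compensated ω K ∂π := by
  have hmt := measurable_changedTime hp hZ t
  have hms := measurable_changedTime hp hZ s
  have hmK : Measurable fun ω => min (jumpTime q ω) K :=
    (measurable_jumpTime q).min measurable_const
  have hτ : Measurable fun ω => min (min (changedTime ydot Z t ω) (jumpTime q ω)) K :=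
    (hmt.min (measurable_jumpTime q)).min measurable_const
  have hB : MeasurableSet (Z ⁻¹' A ∩ {ω | changedTime ydot Z s ω ≤ min (jumpTime q ω) K}) :=
    (hZ (natFiltration.le s _ hA)).inter (measurableSet_le hms hmK)
  refine hπ.optional_stopping hB hτ (fun ω => min_le_right _ _) fun r => ?_
  refine hπ.eventuallyMeasurableSet (hB.inter (measurableSet_le hτ measurable_const)) h ?_
  rintro ω ω' ⟨f, hf⟩ ⟨f', hf'⟩ hag ⟨⟨hωA, hω1⟩, hω2⟩
  simp only [Set.mem_ofPred_eq, hf.path.changedTime_eq, le_min_iff] at hω1 hω2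
  simp only [Set.mem_inter_iff, Set.mem_preimage, Set.mem_ofPred_eq, hf'.path.changedTime_eq,
    le_min_iff]
  -- On the restricted event, stopping by `r` forces `y(Z, s) ≤ r`; hence the atoms of `ω` on `[0,
  -- r]` determine `Z` on `[0, s]`, and with it membership in `Z ⁻¹' A`.
  have hs : f s ≤ r := (le_min (le_min (hf.path.strictMono.monotone hst) hω1.1) hω1.2).trans hω2
  have hfs := hf.path_eq hp hf' hag hs
  refine ⟨⟨((hf.agreeUpTo hp hf' hag hs).mem_iff hA).1 hωA, ?_, ?_⟩, ?_⟩
  · rw [hfs]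
    exact (hag.le_jumpTime_iff hs).1 hω1.1
  · rw [hfs]
    exact hω1.2
  · simp only [min_le_iff] at hω2 ⊢
    rcases hω2 with (h1 | h1) | h1
    · exact Or.inl (Or.inl ((hf.path_eq hp hf' hag h1).trans_le h1))
    · exact Or.inl (Or.inr ((hag.jumpTime_eq h1).trans_le h1))
    · exact Or.inr h1

/-- The bounded identity, taken at `t` and at `s`, gives a zero mean difference on `{y(Z, s) ≤ T_q ∧
K}`. As `K → ∞` this event grows to `{y(Z, s) ≤ T_q}`, off which both stopped times equal `T_q` and
the difference vanishes. The bound `q + T_q` allows the passage to the limit. -/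
theorem IsUnitPoisson.setIntegral_changedTime (hπ : IsUnitPoisson π)
    (hp : IsStronglyPredictable natFiltration ydot) {Z : Config → Config} (hZ : Measurable Z)
    (h : ∀ᵐ ω ∂π, ∃ f, Solves ydot ω (Z ω) f) {s t : ℝ≥0} (hst : s ≤ t) (q : ℕ)
    {A : Set Config} (hA : MeasurableSet[natFiltration s] A) :
    ∫ ω in Z ⁻¹' A, compensated ω (min (changedTime ydot Z t ω) (jumpTime q ω)) ∂π =
      ∫ ω in Z ⁻¹' A, compensated ω (min (changedTime ydot Z s ω) (jumpTime q ω)) ∂π := by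
  have := hπ.isProbabilityMeasure
  have hm := measurable_changedTime hp hZ
  have hmτ : ∀ u, Measurable fun ω => min (changedTime ydot Z u ω) (jumpTime q ω) :=
    fun u => (hm u).min (measurable_jumpTime q)
  have hmτK : ∀ u (K : ℝ≥0),
      Measurable fun ω => min (min (changedTime ydot Z u ω) (jumpTime q ω)) K :=
    fun u K => (hmτ u).min measurable_const
  have hA' : MeasurableSet (Z ⁻¹' A) := hZ (natFiltration.le s _ hA)
  have hdom : Integrable (fun ω => (q : ℝ) + jumpTime q ω) π :=
    (integrable_const _).add (hπ.integrable_jumpTime q)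
  have hiK : ∀ u (K : ℝ≥0), Integrable
      (fun ω => compensated ω (min (min (changedTime ydot Z u ω) (jumpTime q ω)) K)) π :=
    fun u K => hdom.mono' (measurable_compensated (hmτK u K)).aestronglyMeasurable
      (Eventually.of_forall fun ω => abs_compensated_min_jumpTime_le q ω _ _)
  have hi : ∀ u, Integrable
      (fun ω => compensated ω (min (changedTime ydot Z u ω) (jumpTime q ω))) π :=
    fun u => hdom.mono' (measurable_compensated (hmτ u)).aestronglyMeasurable
      (Eventually.of_forall fun ω => by
        have := abs_compensated_min_jumpTime_le q ω (changedTime ydot Z u ω) (jumpTime q ω)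
        rwa [min_assoc, min_self] at this)
  let B : ℕ → Set Config := fun n =>
    Z ⁻¹' A ∩ {ω | changedTime ydot Z s ω ≤ min (jumpTime q ω) (n : ℝ≥0)}
  have hB : ∀ n, MeasurableSet (B n) := fun n =>
    hA'.inter (measurableSet_le (hm s) ((measurable_jumpTime q).min measurable_const))
  let D : ℕ → Config → ℝ := fun n ω =>
    compensated ω (min (min (changedTime ydot Z t ω) (jumpTime q ω)) n) -
      compensated ω (min (min (changedTime ydot Z s ω) (jumpTime q ω)) n)
  have hzero : ∀ n, ∫ ω, (B n).indicator (D n) ω ∂π = 0 := by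
    intro n
    rw [integral_indicator (hB n), integral_sub (hiK t n).integrableOn (hiK s n).integrableOn,
      hπ.setIntegral_changedTime_bounded hp hZ h hst q n hA,
      hπ.setIntegral_changedTime_bounded hp hZ h le_rfl q n hA, sub_self]
  have hlim : Tendsto (fun n => ∫ ω, (B n).indicator (D n) ω ∂π) atTop
      (𝓝 (∫ ω, (Z ⁻¹' A).indicator (fun ω =>
        compensated ω (min (changedTime ydot Z t ω) (jumpTime q ω)) -
          compensated ω (min (changedTime ydot Z s ω) (jumpTime q ω))) ω ∂π)) := by
    refine tendsto_integral_of_dominated_convergence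
      (fun ω => ((q : ℝ) + jumpTime q ω) + ((q : ℝ) + jumpTime q ω))
      (fun n => (((hiK t n).sub (hiK s n)).indicator (hB n)).1) (hdom.add hdom)
      (fun n => Eventually.of_forall fun ω => ?_) ?_
    · refine (norm_indicator_le_norm_self _ _).trans ((norm_sub_le _ _).trans (add_le_add ?_ ?_))
      · exact abs_compensated_min_jumpTime_le q ω _ _
      · exact abs_compensated_min_jumpTime_le q ω _ _
    · filter_upwards [h] with ω ⟨f, hf⟩
      refine tendsto_const_nhds.congr' ?_
      obtain ⟨m, hm⟩ := exists_nat_ge (jumpTime q ω)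
      filter_upwards [eventually_ge_atTop m] with n hn
      have hn' : jumpTime q ω ≤ n := hm.trans (Nat.cast_le.2 hn)
      have hD : D n ω = compensated ω (min (changedTime ydot Z t ω) (jumpTime q ω)) -
          compensated ω (min (changedTime ydot Z s ω) (jumpTime q ω)) := by
        simp only [D]
        rw [min_eq_left ((min_le_right _ _).trans hn'), min_eq_left ((min_le_right _ _).trans hn')]
      by_cases hωA : ω ∈ Z ⁻¹' A
      · by_cases hs : changedTime ydot Z s ω ≤ jumpTime q ω
        · rw [Set.indicator_of_mem hωA,
            Set.indicator_of_mem (show ω ∈ B n from ⟨hωA, le_min hs (hs.trans hn')⟩), hD]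
        · have hs' := (not_le.1 hs).le
          have ht' : jumpTime q ω ≤ changedTime ydot Z t ω := by
            refine hs'.trans ?_
            rw [hf.path.changedTime_eq, hf.path.changedTime_eq]
            exact hf.path.strictMono.monotone hst
          rw [Set.indicator_of_mem hωA,
            Set.indicator_of_notMem (show ω ∉ B n from fun h' => hs (le_min_iff.1 h'.2).1),
            min_eq_right hs', min_eq_right ht', sub_self]
      · rw [Set.indicator_of_notMem hωA,
          Set.indicator_of_notMem (show ω ∉ B n from fun h' => hωA h'.1)]
  simp only [hzero] at hlim
  have h0 := tendsto_nhds_unique hlim tendsto_const_nhds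
  rw [integral_indicator hA', integral_sub (hi t).integrableOn (hi s).integrableOn] at h0
  exact sub_eq_zero.1 h0

/-- The process `N(t ∧ T_q) - y(t ∧ T_q)`. -/
noncomputable def stoppedCompensated (ydot : ℝ≥0 → Config → ℝ) (q : ℕ) (t : ℝ≥0) (z : Config) : ℝ :=
  (count z (min t (jumpTime q z)) : ℝ) - (integrated ydot z (min t (jumpTime q z))).toReal

theorem measurable_stoppedCompensated (hp : IsStronglyPredictable natFiltration ydot) (q : ℕ)
    (t : ℝ≥0) : Measurable[natFiltration t] (stoppedCompensated ydot q t) := by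
  refine measurable_natFiltration_of_agreeUpTo ?_ ?_
  · have h1 : Measurable fun z : Config => (min t (jumpTime q z), z) :=
      (measurable_const.min (measurable_jumpTime q)).prodMk measurable_id
    exact ((measurable_from_top (f := fun n : ℕ => (n : ℝ))).comp
      (measurable_uncurry_count.comp h1)).sub
      (ENNReal.measurable_toReal.comp ((measurable_uncurry_integrated hp).comp h1))
  · intro z z' hag
    have hmin : min t (jumpTime q z) = min t (jumpTime q z') := by
      rcases le_total t (jumpTime q z) with h | h
      · rw [min_eq_left h, min_eq_left ((hag.le_jumpTime_iff le_rfl).1 h)]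
      · rw [hag.jumpTime_eq h]
    rw [stoppedCompensated, stoppedCompensated, ← hmin, hag _ (min_le_left _ _),
      integrated_congr hp fun u hu => hag u (hu.le.trans (min_le_left _ _))]

/-- The increasing map `f` commutes with `min` and sends the `q`-th atom of `Z ω` to that of `ω`. -/
theorem Solves.stoppedCompensated_eq {Z : Config → Config} {ω : Config} {f : ℝ≥0 → ℝ≥0}
    (h : Solves ydot ω (Z ω) f) (q : ℕ) (t : ℝ≥0) : stoppedCompensated ydot q t (Z ω) =
      compensated ω (min (changedTime ydot Z t ω) (jumpTime q ω)) := by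
  rw [stoppedCompensated, compensated, h.count_eq, h.path.eq_coe, h.path.changedTime_eq,
    h.path.strictMono.monotone.map_min, h.path_jumpTime, ENNReal.coe_toReal]

variable {Z : Config → Config}

theorem IsGHawkesProcess.ae_map_exists_isRegularPath (hy : IsPosPredictable π ydot)
    (h : IsGHawkesProcess π ydot Z) : ∀ᵐ z ∂π.map Z, ∃ f, IsRegularPath (integrated ydot z) f :=
  h.absolutelyContinuous.ae_le hy.ae_exists_isRegularPath

theorem IsGHawkesProcess.ae_abs_stoppedCompensated_le (hy : IsPosPredictable π ydot)
    (h : IsGHawkesProcess π ydot Z) (q : ℕ) : ∀ᵐ z ∂π.map Z, ∀ t,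
      |stoppedCompensated ydot q t z| ≤ q + (integrated ydot z (jumpTime q z)).toReal := by
  filter_upwards [h.ae_map_exists_isRegularPath hy] with z ⟨f, hf⟩ t
  have h1 : ((count z (min t (jumpTime q z)) : ℕ) : ℝ) ≤ q := by
    rw [count_min_jumpTime]
    exact Nat.cast_le.2 (min_le_right _ _)
  have h2 : (integrated ydot z (min t (jumpTime q z))).toReal ≤
      (integrated ydot z (jumpTime q z)).toReal := by
    rw [hf.eq_coe, hf.eq_coe]
    exact NNReal.coe_le_coe.2 (hf.strictMono.monotone (min_le_right _ _))
  have h3 : (0 : ℝ) ≤ (count z (min t (jumpTime q z)) : ℕ) := Nat.cast_nonneg _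
  have h4 : 0 ≤ (integrated ydot z (min t (jumpTime q z))).toReal := ENNReal.toReal_nonneg
  rw [stoppedCompensated, abs_le]
  constructor <;> linarith

/-- Pulled back by `Z`, the bound becomes `q + T_q` under `π`, because the clock at the `q`-th atom
of `Z` shows `T_q`. -/
theorem IsGHawkesProcess.integrable_bound (hπ : IsUnitPoisson π) (hy : IsPosPredictable π ydot)
    (h : IsGHawkesProcess π ydot Z) (q : ℕ) :
    Integrable (fun z => (q : ℝ) + (integrated ydot z (jumpTime q z)).toReal) (π.map Z) := by
  have := hπ.isProbabilityMeasure
  have hm : Measurable fun z => (q : ℝ) + (integrated ydot z (jumpTime q z)).toReal :=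
    measurable_const.add (ENNReal.measurable_toReal.comp
      ((measurable_uncurry_integrated hy.predictable).comp
        ((measurable_jumpTime q).prodMk measurable_id)))
  rw [integrable_map_measure hm.aestronglyMeasurable h.measurable.aemeasurable]
  refine ((integrable_const (q : ℝ)).add (hπ.integrable_jumpTime q)).congr ?_
  filter_upwards [h.ae_solves hy] with ω ⟨f, hf⟩
  simp only [Pi.add_apply, Function.comp_apply]
  rw [hf.path.eq_coe, hf.path_jumpTime, ENNReal.coe_toReal]

theorem IsGHawkesProcess.martingale (hπ : IsUnitPoisson π) (hy : IsPosPredictable π ydot)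
    (h : IsGHawkesProcess π ydot Z) (q : ℕ) :
    Martingale (stoppedCompensated ydot q) natFiltration (π.map Z) := by
  have := hπ.isProbabilityMeasure
  have := Measure.isProbabilityMeasure_map (μ := π) h.measurable.aemeasurable
  have hm : ∀ t, Measurable (stoppedCompensated ydot q t) := fun t =>
    (measurable_stoppedCompensated hy.predictable q t).mono (natFiltration.le t) le_rfl
  have hi : ∀ t, Integrable (stoppedCompensated ydot q t) (π.map Z) := fun t =>
    (h.integrable_bound hπ hy q).mono' (hm t).aestronglyMeasurable
      ((h.ae_abs_stoppedCompensated_le hy q).mono fun z hz => hz t)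
  refine ⟨fun t => (measurable_stoppedCompensated hy.predictable q t).stronglyMeasurable,
    fun s t hst => ?_⟩
  refine (ae_eq_condExp_of_forall_setIntegral_eq (natFiltration.le s) (hi t)
    (fun _ _ _ => (hi s).integrableOn) (fun A hA _ => ?_)
    (measurable_stoppedCompensated hy.predictable q s).stronglyMeasurable.aestronglyMeasurable).symm
  have hA' := natFiltration.le s _ hA
  -- Integrals under the law of `Z` become integrals of the time-changed compensated Poisson process
  -- under `π`.
  have hpull : ∀ u, ∫ z in A, stoppedCompensated ydot q u z ∂π.map Z =
      ∫ ω in Z ⁻¹' A, compensated ω (min (changedTime ydot Z u ω) (jumpTime q ω)) ∂π := by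
    intro u
    rw [setIntegral_map hA' (hm u).aestronglyMeasurable h.measurable.aemeasurable]
    refine setIntegral_congr_ae (h.measurable hA') ?_
    filter_upwards [h.ae_solves hy] with ω ⟨f, hf⟩ _
    exact hf.stoppedCompensated_eq q u
  rw [hpull, hpull]
  exact (hπ.setIntegral_changedTime hy.predictable h.measurable (h.ae_solves hy) hst q hA).symm

theorem uniformIntegrable_of_dominated {α ι : Type*} [MeasurableSpace α] {μ : Measure α}
    {f : ι → α → ℝ} {g : α → ℝ} (hf : ∀ i, AEStronglyMeasurable (f i) μ) (hg : Integrable g μ)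
    (hfg : ∀ i, ∀ᵐ x ∂μ, |f i x| ≤ g x) : UniformIntegrable f 1 μ := by
  have hle : ∀ i, ∀ᵐ x ∂μ, ‖f i x‖ ≤ ‖g x‖ := fun i =>
    (hfg i).mono fun x hx => hx.trans (le_abs_self _)
  have hconst : UniformIntegrable (fun _ : ι => g) 1 μ :=
    uniformIntegrable_const le_rfl ENNReal.one_ne_top (memLp_one_iff_integrable.2 hg)
  refine ⟨hf, fun ε hε => ?_, ?_⟩
  · obtain ⟨δ, hδ, hgδ⟩ := hconst.2.1 hε
    refine ⟨δ, hδ, fun i s hs hμs => (eLpNorm_mono_ae ?_).trans (hgδ i s hs hμs)⟩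
    filter_upwards [hle i] with x hx
    by_cases hxs : x ∈ s
    · simpa only [Set.indicator_of_mem hxs] using hx
    · simp only [Set.indicator_of_notMem hxs, norm_zero, le_refl]
  · obtain ⟨C, hC⟩ := hconst.2.2
    exact ⟨C, fun i => (eLpNorm_mono_ae (hle i)).trans (hC i)⟩

theorem IsGHawkesProcess.hasCompensator (hπ : IsUnitPoisson π) (hy : IsPosPredictable π ydot)
    (h : IsGHawkesProcess π ydot Z) : HasCompensator (π.map Z) (integrated ydot) where
  predictable := isStronglyPredictable_integrated hy.predictable
  zero := Eventually.of_forall (integrated_zero ydot)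
  monotone := Eventually.of_forall (integrated_mono ydot)
  finite := by
    filter_upwards [h.ae_map_exists_isRegularPath hy] with z ⟨f, hf⟩ t
    rw [hf.eq_coe]
    exact ENNReal.coe_lt_top
  rightContinuous := by
    filter_upwards [h.ae_map_exists_isRegularPath hy] with z ⟨f, hf⟩ t
    exact hf.continuousWithinAt _ t
  martingale q _ := h.martingale hπ hy q
  uniformIntegrable q _ := uniformIntegrable_of_dominated
    (fun t => ((h.martingale hπ hy q).integrable t).1) (h.integrable_bound hπ hy q)
    fun t => (h.ae_abs_stoppedCompensated_le hy q).mono fun z hz => hz t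

end GHawkes

theorem mainTheorem5 (π : Measure GHawkes.Config) (hπ : GHawkes.IsUnitPoisson π)
    (ydot : ℝ≥0 → GHawkes.Config → ℝ) (hy : GHawkes.IsPosPredictable π ydot) :
    ((∃ (Z : GHawkes.Config → GHawkes.Config) (zstar : GHawkes.Config → ℝ≥0 → ℝ≥0∞),
        GHawkes.IsRightInverse π (GHawkes.mapY ydot) Z ∧
        GHawkes.IsChangeOfTime π zstar ∧
        ∀ᵐ ω ∂π, GHawkes.IsTimeChanged (zstar ω) ω (Z ω)) ↔
      ∃ Z : GHawkes.Config → GHawkes.Config, GHawkes.IsGHawkesProcess π ydot Z) ∧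
    ∀ Z : GHawkes.Config → GHawkes.Config, GHawkes.IsGHawkesProcess π ydot Z →
      GHawkes.HasCompensator (π.map Z) (GHawkes.integrated ydot) := by
  refine ⟨⟨?_, ?_⟩, fun Z hZ => hZ.hasCompensator hπ hy⟩
  · rintro ⟨Z, -, hZ, -, -⟩
    exact ⟨Z, hZ.isGHawkesProcess hπ hy⟩
  · rintro ⟨Z, hZ⟩
    exact ⟨Z, _, hZ.isRightInverse hy, hZ.isChangeOfTime hy, hZ.equation⟩
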